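/- Let $\mathbb{RP}^1$ be the space of real lines through $0$ in $\mathbb{C}$, let $2\mathrm{Arg}:\mathbb{C}^\times\to\mathbb{RP}^1$ send $z$ to the line $\mathbb{R}z$, and regard $\mathbb{RP}^2=\mathbb{C}\cup\mathbb{RP}^1$ as the compactification of $\mathbb{C}$ by a line at infinity. For an affine plane $V\subset\mathbb{C}^4$, the rolled coamoeba map $\mathcal{B}:V\cap(\mathbb{C}^\times)^4\to(\mathbb{RP}^1)^4$ is the restriction of the coordinatewise map $2\mathrm{Arg}$, and $\mathcal{B}_Z\subset(\mathbb{RP}^1)^4$, with the subspace topology, is its set of critical values (values at the points where the differential of $\mathcal{B}$ as a map of real 4-manifolds is not surjective). For a generic affine plane $V$, the space $\mathcal{B}_Z$ is homeomorphic to $\mathbb{RP}^2$ blown up at four points. Here $V$ is parametrized as $\{(m_{i0}t_0+m_{i1}t_1+m_{i2})_{i=0,\dots,3} : t_0,t_1\in\mathbb{C}\}$, and generic means: there is a nonzero real polynomial in the real and imaginary parts of the $m_{ij}$ such that the statement holds for all $V$ whose parameters are not zeros of it. More precisely, for such $V$ there are $c\in(\mathbb{C}^\times)^4$ and $a,k\in\mathbb{C}$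 such that the coordinatewise rescaling $c\cdot V$ is the plane $\{(x,y,x+y-1,x+ky-a) : x,y\in\mathbb{C}\}$. For $b\in\mathcal{B}_Z$ let $(l_0,l,l_1,l_a)=c\cdot b$ be the correspondingly rotated quadruple of lines. There are a point $d\in\mathbb{C}$ with $0,1,a,d$ pairwise distinct, and a pencil of real conics $C_l\subset\mathbb{RP}^2$, $l\in\mathbb{RP}^1$ (the zero set of $Q_v$ for any $0\ne v\in l$, where $v\mapsto Q_v$ is an injective real-linear map from $\mathbb{C}$ to the real quadratic forms in three variables), with set of base points exactly $\{0,1,a,d\}$, such that: 1. for every $b\in\mathcal{B}_Z$ the closures in $\mathbb{RP}^2$ of the lines $l_0$, $l_1+1$, $l_a+a$ have exactly one common point, denoted $\phi(b)$; 2. $b\mapsto(\phi(b),l)$ is a homeomorphism from $\mathcal{B}_Z$ onto the universal curve $\tilde C=\{(p,l)\in\mathbb{RP}^2\times\mathbb{RP}^1 : p\in C_l\}$; 3. there is a homeomorphism from $\mathcal{B}_Z$ to the blow-up of $\mathbb{RP}^2$ at $0,1,a,d$ whose composition with the blow-down map to $\mathbb{RP}^2$ is $\phi$. -/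

import Mathlib

open scoped LinearAlgebra.Projectivization

noncomputable section

/-- The quotient topology on a projective space. -/
instance Projectivization.quotientTopology {K V : Type*} [DivisionRing K] [AddCommGroup V]
    [Module K V] [TopologicalSpace V] : TopologicalSpace (ℙ K V) :=
  TopologicalSpace.coinduced (Projectivization.mk' K) inferInstance

/-- The real projective line, as the space of real lines through the origin of `ℂ`. -/
abbrev RP1 : Type := ℙ ℝ ℂ

/-- The real projective plane, with homogeneous coordinates `[z : w]`, `z ∈ ℂ`, `w ∈ ℝ`. It is the
compactification of `ℂ` (where `w ≠ 0`) by the line `RP1` at infinity (where `w = 0`). -/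
abbrev RP2 : Type := ℙ ℝ (ℂ × ℝ)

/-- The point `[s : 1]` of the real projective plane. -/
def affinePoint (s : ℂ) : RP2 :=
  Projectivization.mk ℝ ((s, 1) : ℂ × ℝ) (fun h => one_ne_zero (congrArg Prod.snd h))

/-- The closure in `RP2` of the affine line `l + s` in `ℂ`, where `l` is a line through the origin:
the projective line of all `[z : w]` with `z - w s ∈ l`. -/
def projLine (s : ℂ) (l : RP1) : Set RP2 :=
  {p | ∀ x ∈ p.submodule, x.1 - (x.2 : ℂ) * s ∈ l.submodule}

/-- The real line spanned by a nonzero complex number `z`, that is `[Re z : Im z]`.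
(The value at `0` is never used.) -/
def twoArg (z : ℂ) : RP1 :=
  if h : z ≠ 0 then Projectivization.mk ℝ z h else Projectivization.mk ℝ 1 one_ne_zero

/-- The affine chart of `RP1` centred at the line spanned by `z ≠ 0`: it sends the line spanned by
`z * (ξ + i η)`, with `ξ ≠ 0`, to `η / ξ`. -/
def slopeChart (z : ℂ) (l : RP1) : ℝ :=
  (l.rep / z).im / (l.rep / z).re

/-- `v` is a critical point of the rolled coamoeba map of `V`, the coordinatewise `twoArg` on
`V ∩ (ℂ \ {0})⁴`: the differential at `v` of this map, in the charts of `RP1` centred at its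
value, is not surjective. -/
def IsCriticalPoint (V : AffineSubspace ℂ (Fin 4 → ℂ)) (v : Fin 4 → ℂ) : Prop :=
  v ∈ V ∧ (∀ i, v i ≠ 0) ∧
    ¬ Function.Surjective
      (fderiv ℝ (fun (w : V.direction) (i : Fin 4) =>
        slopeChart (v i) (twoArg (v i + (w : Fin 4 → ℂ) i))) 0)

/-- The set of critical values of the rolled coamoeba map of `V`. -/
def criticalValues (V : AffineSubspace ℂ (Fin 4 → ℂ)) : Set (Fin 4 → RP1) :=
  {l | ∃ v, IsCriticalPoint V v ∧ l = fun i => twoArg (v i)}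

/-- The image of `(t₀, t₁) ↦ (M i 0 * t₀ + M i 1 * t₁ + M i 2)_i`, an affine plane in `ℂ⁴` if the
first two columns of `M` are linearly independent. -/
def planeOf (M : Matrix (Fin 4) (Fin 3) ℂ) : AffineSubspace ℂ (Fin 4 → ℂ) :=
  AffineSubspace.mk' (fun i => M i 2) (Submodule.span ℂ {fun i => M i 0, fun i => M i 1})

/-- The plane of all points `(x, y, x + y - 1, x + k y - a)`. -/
def normalPlane (a k : ℂ) : AffineSubspace ℂ (Fin 4 → ℂ) :=
  planeOf !![1, 0, 0; 0, 1, 0; 1, 1, -1; 1, k, -a]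

/-- The real and imaginary parts of the entries of `M`, as a point of real affine 24-space. -/
def realCoords (M : Matrix (Fin 4) (Fin 3) ℂ) : Fin 4 × Fin 3 × Fin 2 → ℝ :=
  fun t => ![(M t.1 t.2.1).re, (M t.1 t.2.1).im] t.2.2

/-- The conic in `RP2` defined by a real quadratic form in three variables. -/
def conic (q : QuadraticForm ℝ (ℂ × ℝ)) : Set RP2 :=
  {p | ∀ x ∈ p.submodule, q x = 0}

/-- The universal curve `{(p, l) | p ∈ C_l}` of the pencil of conics `C_l`, `l ∈ RP1`, where
`C_l` is defined by the form `Q v` for any `v ≠ 0` on the line `l`. -/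
def universalCurve (Q : ℂ →ₗ[ℝ] QuadraticForm ℝ (ℂ × ℝ)) : Set (RP2 × RP1) :=
  {q | ∀ v ∈ q.2.submodule, q.1 ∈ conic (Q v)}

/-- The blow-up of `RP2` at distinct points `s i` of `ℂ`: a point `p` of `RP2` together with,
for every `i`, (the direction of) a projective line through `s i` which contains `p`. -/
def blowUp {ι : Type*} (s : ι → ℂ) : Set (RP2 × (ι → RP1)) :=
  {q | ∀ i, q.1 ∈ projLine (s i) (q.2 i)}

end

/-! Domain and target of the rolled coamoeba map have the same real dimension, so a point is
critical exactly when some nonzero tangent vector has each coordinate on the same real line as the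
corresponding coordinate of the point (`isCriticalPoint_iff`). In normal form, write the point as
(x, y, x + y - 1, x + ky - a) and the tangent vector as (ξ, η, ξ + η, ξ + kη). If η ≠ 0, then y = rη
with r real. Subtracting r times the tangent vector gives (p, 0, p - 1, p - a), with every
coordinate still on its line, so p lies on l_0, l_1 + 1 and l_a + a. If η = 0, the three lines are
parallel to ξ and meet at infinity. The common point is unique because 0, 1, a are not collinear.

Conversely, fix p in ℂ away from the base points 0, 1, a and a nonzero v in l. A tangent vector with
η = v has ξ = rp, where r Im p = Im(v conj(p - 1)) and r Im(p conj a) = Im(kv conj(p - a)).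
Eliminating r leaves Im(F(p) conj v) = 0 with F(p) = Im p · conj k · (p - a) - Im(p conj a) · (p -
1). Thus p lies on the member of a pencil of conics indexed by l; the homogenized F is `conicMap`.
For general a and k its zeros are 0, 1, a and a fourth point, all simple.

The topology is handled for any quadratic map F to ℂ with simple zeros s_i. The compact set
`resolution` records a point, a direction through it at each s_i, and a member of the pencil.
Forgetting the directions gives the universal curve, and forgetting the member gives the blow-up.
Both projections are bijective because the differential of F at s_i matches directions with members
of the pencil. A continuous bijection from a compact space to a Hausdorff space is a homeomorphism.
The critical values are a third bijective image: the member together with the directions at 0, 1, a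
(`exists_homeomorph_criticalValues`).

Each general position condition is the nonvanishing of a rational function of the parameters that is
regular and nonzero at one sample plane; multiplying numerators and denominators gives the
polynomial. -/

namespace Projectivization

/-! ### Projective spaces: representatives and topology -/

section Algebra

variable {K V : Type*} [DivisionRing K] [AddCommGroup V] [Module K V]

theorem mem_submodule_mk {v w : V} {hv : v ≠ 0} :
    w ∈ (mk K v hv).submodule ↔ ∃ a : K, a • v = w := by
  rw [submodule_mk, Submodule.mem_span_singleton]

theorem self_mem_submodule_mk (v : V) (hv : v ≠ 0) : v ∈ (mk K v hv).submodule :=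
  mem_submodule_mk.2 ⟨1, one_smul K v⟩

theorem rep_mem_submodule (p : ℙ K V) : p.rep ∈ p.submodule := by
  rw [submodule_eq]
  exact Submodule.mem_span_singleton_self _

theorem eq_mk_of_mem_submodule {p : ℙ K V} {v : V} (hv : v ≠ 0) (h : v ∈ p.submodule) :
    p = mk K v hv := by
  induction p with
  | h u hu =>
    obtain ⟨a, rfl⟩ := mem_submodule_mk.1 h
    exact ((mk_eq_mk_iff' K _ _ hv hu).2 ⟨a, rfl⟩).symm

theorem eq_of_mem_submodule {p q : ℙ K V} {v : V} (hv : v ≠ 0) (hp : v ∈ p.submodule)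
    (hq : v ∈ q.submodule) : p = q :=
  (eq_mk_of_mem_submodule hv hp).trans (eq_mk_of_mem_submodule hv hq).symm

theorem exists_smul_of_mem_submodule {p : ℙ K V} {v w : V} (hv : v ≠ 0) (h : v ∈ p.submodule)
    (hw : w ∈ p.submodule) : ∃ a : K, w = a • v := by
  obtain rfl := eq_mk_of_mem_submodule hv h
  obtain ⟨a, rfl⟩ := mem_submodule_mk.1 hw
  exact ⟨a, rfl⟩

theorem smul_mem_submodule_smul {G : Type*} [Group G] [DistribMulAction G V] [SMulCommClass G K V]
    (g : G) {p : ℙ K V} {v : V} (h : v ∈ p.submodule) : g • v ∈ (g • p).submodule := by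
  induction p with
  | h u hu =>
    obtain ⟨a, rfl⟩ := mem_submodule_mk.1 h
    rw [smul_mk, mem_submodule_mk]
    exact ⟨a, (smul_comm g a u).symm⟩

end Algebra

theorem continuous_mk {K V X : Type*} [DivisionRing K] [AddCommGroup V] [Module K V]
    [TopologicalSpace V] [TopologicalSpace X] {f : X → V} (hf : Continuous f)
    (h : ∀ x, f x ≠ 0) : Continuous fun x => mk K (f x) (h x) := by
  have h1 : Continuous (mk' K : {v : V // v ≠ 0} → ℙ K V) := continuous_coinduced_rng
  exact h1.comp (hf.subtype_mk h)

theorem continuous_of_comp_mk {K V X : Type*} [DivisionRing K] [AddCommGroup V] [Module K V]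
    [TopologicalSpace V] [TopologicalSpace X] {f : ℙ K V → X}
    (h : Continuous fun v : {v : V // v ≠ 0} => f (mk K v.1 v.2)) : Continuous f :=
  continuous_coinduced_dom.2 h

theorem continuous_smul_of_continuous {K V G : Type*} [DivisionRing K] [AddCommGroup V] [Module K V]
    [TopologicalSpace V] [Group G] [DistribMulAction G V] [SMulCommClass G K V]
    [ContinuousConstSMul G V] (g : G) : Continuous fun p : ℙ K V => g • p :=
  continuous_of_comp_mk (continuous_mk (continuous_subtype_val.const_smul g) _)

theorem exists_norm_eq_one_mem {V : Type*} [NormedAddCommGroup V] [NormedSpace ℝ V]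
    (p : ℙ ℝ V) : ∃ v ∈ p.submodule, ‖v‖ = 1 := by
  refine ⟨‖p.rep‖⁻¹ • p.rep, Submodule.smul_mem _ _ p.rep_mem_submodule, ?_⟩
  rw [norm_smul, norm_inv, norm_norm, inv_mul_cancel₀ (norm_ne_zero_iff.2 p.rep_nonzero)]

/-- Choose a linear form g that kills p but not q. The function |g v| / ‖v‖ is well defined and
continuous on the projective space, and it separates the two points. -/
instance {V : Type*} [NormedAddCommGroup V] [NormedSpace ℝ V] [FiniteDimensional ℝ V] :
    T2Space (ℙ ℝ V) := by
  refine ⟨fun p q hpq => ?_⟩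
  have hq : q.rep ∉ p.submodule := fun h =>
    hpq (eq_of_mem_submodule q.rep_nonzero h q.rep_mem_submodule)
  obtain ⟨g, hg, hpg⟩ := Submodule.exists_le_ker_of_notMem hq
  have hgc : Continuous g := g.continuous_of_finiteDimensional
  let f : ℙ ℝ V → ℝ := Projectivization.lift (fun v => |g v.1| / ‖v.1‖) (by
    rintro ⟨v, hv⟩ ⟨w, hw⟩ t h
    have ht : t ≠ 0 := by
      rintro rfl
      exact hv (by simpa using h)
    have h' : v = t • w := h
    subst h'
    simp only [map_smul, smul_eq_mul, abs_mul, norm_smul, Real.norm_eq_abs]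
    exact mul_div_mul_left _ _ (abs_ne_zero.2 ht))
  have hf : ∀ v hv, f (mk ℝ v hv) = |g v| / ‖v‖ := fun v hv => Projectivization.lift_mk ..
  have hfc : Continuous f := by
    refine continuous_of_comp_mk ?_
    simp only [hf]
    exact ((hgc.comp continuous_subtype_val).abs).div continuous_subtype_val.norm
      fun v => norm_ne_zero_iff.2 v.2
  refine separated_by_continuous hfc ?_
  rw [← mk_rep p, ← mk_rep q, hf, hf]
  have hp : g p.rep = 0 := hpg p.rep_mem_submodule
  rw [hp, abs_zero, zero_div]
  exact (div_ne_zero (abs_ne_zero.2 hg) (norm_ne_zero_iff.2 q.rep_nonzero)).symm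

end Projectivization

open Projectivization
open QuadraticMap (polar)

theorem mem_submodule_mk_iff_im_eq_zero {v w : ℂ} {hv : v ≠ 0} :
    w ∈ (mk ℝ v hv).submodule ↔ (w * star v).im = 0 := by
  rw [mem_submodule_mk]
  constructor
  · rintro ⟨a, rfl⟩
    simp
    ring
  · intro h
    refine ⟨(w * star v).re / Complex.normSq v, ?_⟩
    have h2 : (Complex.normSq v : ℂ) ≠ 0 := by simpa using hv
    have h1 : w * star v = ((w * star v).re : ℂ) := Complex.ext rfl (by simpa using h)
    rw [Complex.real_smul, Complex.ofReal_div, ← h1, div_mul_eq_mul_div, mul_assoc, mul_comm (star v)]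
    change w * (v * (starRingEnd ℂ) v) / _ = _
    rw [Complex.mul_conj, mul_div_cancel_right₀ _ h2]

theorem im_mul_star_eq_zero_of_mem {l : RP1} {v w : ℂ} (hv : v ∈ l.submodule)
    (hw : w ∈ l.submodule) : (w * star v).im = 0 := by
  by_cases h : v = 0
  · simp [h]
  · obtain rfl := eq_mk_of_mem_submodule h hv
    exact mem_submodule_mk_iff_im_eq_zero.1 hw

theorem mem_submodule_of_im_mul_star_eq_zero {l : RP1} {v w : ℂ} (h : v ≠ 0)
    (hv : v ∈ l.submodule) (hw : (w * star v).im = 0) : w ∈ l.submodule := by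
  obtain rfl := eq_mk_of_mem_submodule h hv
  exact mem_submodule_mk_iff_im_eq_zero.2 hw

/-- A continuous injection of a compact space into a Hausdorff space is a homeomorphism onto its
range. -/
theorem exists_homeomorph_of_range_eq {X Y : Type*} [TopologicalSpace X] [TopologicalSpace Y]
    [CompactSpace X] [T2Space Y] {f : X → Y} (hf : Continuous f) (hi : Function.Injective f)
    {S : Set Y} (hS : Set.range f = S) : ∃ e : X ≃ₜ S, ∀ x, (e x : Y) = f x := by
  subst hS
  exact ⟨(hf.isClosedEmbedding hi).isEmbedding.toHomeomorph, fun x => rfl⟩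

/-- The common zeros of the real quadratic map `F`, seen as a pencil of conics, are the points
`s i`; they are distinct and simple. -/
structure IsSimpleBaseLocus {ι : Type*} (F : QuadraticMap ℝ (ℂ × ℝ) ℂ) (s : ι → ℂ) : Prop where
  continuous : Continuous F
  injective : Function.Injective s
  map_base : ∀ i, F (s i, 1) = 0
  exists_eq : ∀ x : ℂ × ℝ, x ≠ 0 → F x = 0 → ∃ i, x.1 = (x.2 : ℂ) * s i
  polar_ne_zero : ∀ i (v : ℂ), v ≠ 0 → polar F (s i, 1) (v, 0) ≠ 0

/-- The points of the blow-up at the points `s i` together with a member of the pencil `F`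
through them. -/
def resolution {ι : Type*} (F : QuadraticMap ℝ (ℂ × ℝ) ℂ) (s : ι → ℂ) :
    Set (RP2 × (ι → RP1) × RP1) :=
  {q | (∀ i, q.1 ∈ projLine (s i) (q.2.1 i)) ∧
    ∀ i, ∀ x ∈ q.1.submodule, ∀ v ∈ (q.2.1 i).submodule,
      polar F (x + x.2 • (s i, 1)) (v, 0) ∈ q.2.2.submodule}

/-! ### Quadratic maps to `ℂ` as pencils of conics -/

theorem mem_projLine_of_mem {s : ℂ} {l : RP1} {p : RP2} {x : ℂ × ℝ} (hx : x ≠ 0)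
    (hp : x ∈ p.submodule) (h : x.1 - (x.2 : ℂ) * s ∈ l.submodule) : p ∈ projLine s l := by
  intro y hy
  obtain ⟨r, rfl⟩ := exists_smul_of_mem_submodule hx hp hy
  convert l.submodule.smul_mem r h using 1
  simp
  ring

/-- The pencil of conics of all forms `Im (F x * conj v)`, for `v` in `ℂ`. -/
noncomputable def pencil (F : QuadraticMap ℝ (ℂ × ℝ) ℂ) :
    ℂ →ₗ[ℝ] QuadraticForm ℝ (ℂ × ℝ) where
  toFun v := (Complex.imLm ∘ₗ LinearMap.mulRight ℝ (star v)).compQuadraticMap F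
  map_add' v w := by
    ext x
    simp [mul_add]
  map_smul' r v := by
    ext x
    simp
    ring

theorem pencil_apply (F : QuadraticMap ℝ (ℂ × ℝ) ℂ) (v : ℂ) (x : ℂ × ℝ) :
    pencil F v x = (F x * star v).im := rfl

theorem mem_universalCurve_pencil {F : QuadraticMap ℝ (ℂ × ℝ) ℂ} {q : RP2 × RP1} :
    q ∈ universalCurve (pencil F) ↔ ∀ x ∈ q.1.submodule, F x ∈ q.2.submodule := by
  constructor
  · intro h x hx
    exact mem_submodule_of_im_mul_star_eq_zero q.2.rep_nonzero q.2.rep_mem_submodule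
      (h _ q.2.rep_mem_submodule x hx)
  · intro h v hv x hx
    exact im_mul_star_eq_zero_of_mem hv (h x hx)

theorem mem_universalCurve_pencil_of_mem {F : QuadraticMap ℝ (ℂ × ℝ) ℂ} {p : RP2} {l : RP1}
    {x : ℂ × ℝ} (hx : x ≠ 0) (hp : x ∈ p.submodule) (h : F x ∈ l.submodule) :
    (p, l) ∈ universalCurve (pencil F) := by
  refine mem_universalCurve_pencil.2 fun y hy => ?_
  obtain ⟨r, rfl⟩ := exists_smul_of_mem_submodule hx hp hy
  rw [QuadraticMap.map_smul]
  exact l.submodule.smul_mem _ h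

/-- With S = (s, 1) and w = x.2, this is the polarization of F(x) - F(wS), that is, half the polar
form at x + wS and x - wS. Away from s it makes the polar condition in `resolution` say that F(x)
lies on the line of the member. At s that condition becomes one on the differential of F, so the
condition stays closed. -/
theorem two_smul_map_eq_smul_polar {F : QuadraticMap ℝ (ℂ × ℝ) ℂ} {s v : ℂ} {x : ℂ × ℝ} {r : ℝ}
    (h : F (s, 1) = 0) (hx : x.1 - (x.2 : ℂ) * s = r • v) :
    (2 : ℝ) • F x = r • polar F (x + x.2 • (s, 1)) (v, 0) := by
  have h1 : x = x.2 • ((s, 1) : ℂ × ℝ) + r • ((v, 0) : ℂ × ℝ) := by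
    ext1
    · rw [Prod.fst_add, Prod.smul_fst, Prod.smul_fst, ← hx, Complex.real_smul]
      ring
    · simp
  generalize x.2 = w at *
  generalize ((v, 0) : ℂ × ℝ) = V at *
  generalize ((s, 1) : ℂ × ℝ) = S at *
  subst h1
  rw [QuadraticMap.map_add F, QuadraticMap.map_smul, QuadraticMap.map_smul, h,
    QuadraticMap.polar_add_left, QuadraticMap.polar_add_left, QuadraticMap.polar_smul_left,
    QuadraticMap.polar_smul_left, QuadraticMap.polar_smul_left, QuadraticMap.polar_self,
    QuadraticMap.polar_smul_right]
  module

theorem fst_sub_smul_ne_zero {s t : ℂ} (hst : t ≠ s) {x : ℂ × ℝ} (hx : x ≠ 0)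
    (h : x.1 = (x.2 : ℂ) * s) : x.1 - (x.2 : ℂ) * t ≠ 0 := by
  intro h'
  rw [h, ← mul_sub] at h'
  rcases mul_eq_zero.1 h' with h2 | h2
  · refine hx (Prod.ext ?_ ?_)
    · rw [h, h2, zero_mul, Prod.fst_zero]
    · exact_mod_cast h2
  · exact hst (sub_eq_zero.1 h2).symm

theorem snd_ne_zero_of_fst_eq {s : ℂ} {x : ℂ × ℝ} (hx : x ≠ 0) (h : x.1 = (x.2 : ℂ) * s) :
    x.2 ≠ 0 := by
  intro h2
  refine hx (Prod.ext ?_ h2)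
  rw [h, h2, Complex.ofReal_zero, zero_mul, Prod.fst_zero]

theorem polar_add_smul_of_fst_eq {F : QuadraticMap ℝ (ℂ × ℝ) ℂ} {s : ℂ} {x y : ℂ × ℝ}
    (h : x.1 = (x.2 : ℂ) * s) :
    polar F (x + x.2 • (s, 1)) y = (2 * x.2) • polar F (s, 1) y := by
  have h1 : x + x.2 • ((s, 1) : ℂ × ℝ) = (2 * x.2) • (s, 1) := by
    ext1
    · simp [h]
      ring
    · simp
      ring
  rw [h1, QuadraticMap.polar_smul_left]

theorem polar_mem_iff_of_fst_eq {F : QuadraticMap ℝ (ℂ × ℝ) ℂ} {s : ℂ} {l m : RP1} {p : RP2} {x : ℂ × ℝ}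
    (hx0 : x ≠ 0) (hx : x ∈ p.submodule) (hp : x.1 = (x.2 : ℂ) * s) {u : ℂ} (hu : u ≠ 0)
    (hul : u ∈ l.submodule) :
    (∀ x ∈ p.submodule, ∀ v ∈ l.submodule,
      polar F (x + x.2 • (s, 1)) (v, 0) ∈ m.submodule) ↔
      polar F (s, 1) (u, 0) ∈ m.submodule := by
  constructor
  · intro hm
    have h1 := hm x hx u hul
    rw [polar_add_smul_of_fst_eq hp] at h1
    exact (Submodule.smul_mem_iff _
      (mul_ne_zero two_ne_zero (snd_ne_zero_of_fst_eq hx0 hp))).1 h1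
  · intro hm y hy v hv
    obtain ⟨r, rfl⟩ := exists_smul_of_mem_submodule hx0 hx hy
    obtain ⟨t, rfl⟩ := exists_smul_of_mem_submodule hu hul hv
    have e2 : ((t • u, 0) : ℂ × ℝ) = t • (u, 0) := by simp
    rw [polar_add_smul_of_fst_eq (by simp [hp, mul_assoc]), e2, QuadraticMap.polar_smul_right]
    exact Submodule.smul_mem _ _ (Submodule.smul_mem _ _ hm)

/-! ### The resolution, the universal curve and the blow-up -/

namespace IsSimpleBaseLocus

variable {ι : Type*} {F : QuadraticMap ℝ (ℂ × ℝ) ℂ} {s : ι → ℂ}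

theorem exists_polar_eq (h : IsSimpleBaseLocus F s) (i : ι) (z : ℂ) :
    ∃ v : ℂ, polar F (s i, 1) (v, 0) = z := by
  have h1 : Function.Injective ((F.polarBilin (s i, 1)).comp (LinearMap.inl ℝ ℂ ℝ)) := by
    rw [← LinearMap.ker_eq_bot, LinearMap.ker_eq_bot']
    intro v hv
    by_contra hne
    exact h.polar_ne_zero i v hne hv
  exact LinearMap.injective_iff_surjective.1 h1 z

theorem isCompact_resolution [Finite ι] (h : IsSimpleBaseLocus F s) :
    IsCompact (resolution F s) := by
  have hF := h.continuous
  -- Unit representatives: the defining conditions are closed and homogeneous, so `K` is compact and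
  -- maps onto the resolution.
  let K : Set ((ℂ × ℝ) × (ι → ℂ) × ℂ) :=
    (Metric.sphere 0 1 ×ˢ (Set.univ.pi fun _ => Metric.sphere 0 1) ×ˢ Metric.sphere 0 1) ∩
    {q | (∀ i, ((q.1.1 - (q.1.2 : ℂ) * s i) * star (q.2.1 i)).im = 0) ∧
      ∀ i, (polar F (q.1 + q.1.2 • (s i, 1)) (q.2.1 i, 0) * star q.2.2).im = 0}
  have hK : IsCompact K := by
    refine IsCompact.inter_right ((isCompact_sphere _ _).prod
      ((isCompact_univ_pi fun _ => isCompact_sphere _ _).prod (isCompact_sphere _ _))) ?_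
    have h1 : Continuous fun q : (ℂ × ℝ) × (ι → ℂ) × ℂ => fun i =>
        ((q.1.1 - (q.1.2 : ℂ) * s i) * star (q.2.1 i)).im := by fun_prop
    have h2 : Continuous fun q : (ℂ × ℝ) × (ι → ℂ) × ℂ => fun i =>
        (polar F (q.1 + q.1.2 • (s i, 1)) (q.2.1 i, 0) * star q.2.2).im := by
      unfold polar
      fun_prop
    convert (isClosed_eq h1 continuous_zero).inter (isClosed_eq h2 continuous_zero) using 1
    ext q
    exact and_congr funext_iff.symm funext_iff.symm
  have hne : ∀ {E : Type} [NormedAddCommGroup E] {v : E}, v ∈ Metric.sphere (0 : E) 1 → v ≠ 0 := by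
    intro E _ v hv hv0
    simp [hv0] at hv
  have h1 : ∀ q : K, q.1.1 ≠ 0 := fun q => hne q.2.1.1
  have h2 : ∀ (q : K) (i : ι), q.1.2.1 i ≠ 0 := fun q i => hne (q.2.1.2.1 i trivial)
  have h3 : ∀ q : K, q.1.2.2 ≠ 0 := fun q => hne q.2.1.2.2
  let g : K → RP2 × (ι → RP1) × RP1 := fun q =>
    (Projectivization.mk ℝ q.1.1 (h1 q), fun i => Projectivization.mk ℝ (q.1.2.1 i) (h2 q i), Projectivization.mk ℝ q.1.2.2 (h3 q))
  have hg : Continuous g := by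
    refine (continuous_mk (by fun_prop) _).prodMk
      ((continuous_pi fun i => continuous_mk (by fun_prop) fun q => h2 q i).prodMk
        (continuous_mk (by fun_prop) _))
  have : CompactSpace K := isCompact_iff_compactSpace.1 hK
  convert isCompact_range hg
  ext ⟨p, l, m⟩
  constructor
  · rintro ⟨ha, hb⟩
    obtain ⟨x, hx, hx1⟩ := exists_norm_eq_one_mem p
    choose v hv hv1 using fun i => exists_norm_eq_one_mem (l i)
    obtain ⟨z, hz, hz1⟩ := exists_norm_eq_one_mem m
    refine ⟨⟨(x, v, z), ⟨⟨by simpa using hx1, fun i _ => by simpa using hv1 i,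
      by simpa using hz1⟩, fun i => im_mul_star_eq_zero_of_mem (hv i) (ha i x hx),
      fun i => im_mul_star_eq_zero_of_mem hz (hb i x hx _ (hv i))⟩⟩, ?_⟩
    exact Prod.ext (eq_mk_of_mem_submodule _ hx).symm (Prod.ext
      (funext fun i => (eq_mk_of_mem_submodule _ (hv i)).symm) (eq_mk_of_mem_submodule _ hz).symm)
  · rintro ⟨q, hq⟩
    obtain ⟨rfl, rfl, rfl⟩ : Projectivization.mk ℝ q.1.1 (h1 q) = p ∧
        (fun i => Projectivization.mk ℝ (q.1.2.1 i) (h2 q i)) = l ∧ Projectivization.mk ℝ q.1.2.2 (h3 q) = m := by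
      simpa [g, Prod.ext_iff] using hq
    refine ⟨fun i => mem_projLine_of_mem (h1 q) (self_mem_submodule_mk _ _)
      (mem_submodule_mk_iff_im_eq_zero.2 (q.2.2.1 i)), fun i y hy v hv => ?_⟩
    obtain ⟨r, rfl⟩ := mem_submodule_mk.1 hy
    obtain ⟨t, rfl⟩ := mem_submodule_mk.1 hv
    have e1 : r • q.1.1 + (r • q.1.1).2 • ((s i, 1) : ℂ × ℝ) =
        r • (q.1.1 + q.1.1.2 • (s i, 1)) := by
      rw [Prod.smul_snd, smul_add, smul_eq_mul, mul_smul]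
    have e2 : ((t • q.1.2.1 i, 0) : ℂ × ℝ) = t • (q.1.2.1 i, 0) := by simp
    rw [e1, e2, QuadraticMap.polar_smul_left, QuadraticMap.polar_smul_right]
    exact Submodule.smul_mem _ _ (Submodule.smul_mem _ _
      (mem_submodule_mk_iff_im_eq_zero.2 (q.2.2.2 i)))

theorem map_mem_of_mem_resolution [Nonempty ι] (h : IsSimpleBaseLocus F s)
    {q : RP2 × (ι → RP1) × RP1} (hq : q ∈ resolution F s) {x : ℂ × ℝ} (hx : x ∈ q.1.submodule) :
    F x ∈ q.2.2.submodule := by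
  obtain ⟨i⟩ := ‹Nonempty ι›
  obtain ⟨r, hr⟩ := exists_smul_of_mem_submodule (q.2.1 i).rep_nonzero
    (q.2.1 i).rep_mem_submodule (hq.1 i x hx)
  have h1 := two_smul_map_eq_smul_polar (h.map_base i) hr
  have h2 := hq.2 i x hx _ (q.2.1 i).rep_mem_submodule
  have h3 : F x = (2⁻¹ * r) • polar F (x + x.2 • (s i, 1)) ((q.2.1 i).rep, 0) := by
    rw [mul_smul, ← h1, smul_smul]
    norm_num
  rw [h3]
  exact Submodule.smul_mem _ _ h2

/-- The direction `l i` is compatible with the pencil as soon as the point is not `s i`. -/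
theorem polar_mem_of_ne (h : IsSimpleBaseLocus F s) {i : ι} {l m : RP1} {x : ℂ × ℝ} {v : ℂ}
    (hne : x.1 - (x.2 : ℂ) * s i ≠ 0) (hx : x.1 - (x.2 : ℂ) * s i ∈ l.submodule)
    (hF : F x ∈ m.submodule) (hv : v ∈ l.submodule) :
    polar F (x + x.2 • (s i, 1)) (v, 0) ∈ m.submodule := by
  obtain ⟨r, rfl⟩ := exists_smul_of_mem_submodule hne hx hv
  have h1 := two_smul_map_eq_smul_polar (x := x) (h.map_base i) (one_smul ℝ _).symm
  rw [one_smul] at h1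
  have e2 : ((r • (x.1 - (x.2 : ℂ) * s i), 0) : ℂ × ℝ) = r • (x.1 - (x.2 : ℂ) * s i, 0) := by simp
  rw [e2, QuadraticMap.polar_smul_right, ← h1]
  exact Submodule.smul_mem _ _ (Submodule.smul_mem _ _ hF)

/-- A family of directions on the blow-up over `p` (and a member of the pencil) is a point of the
resolution as soon as the compatibility condition holds at `p` itself. -/
theorem mem_resolution_of_mem (h : IsSimpleBaseLocus F s) {q : RP2 × (ι → RP1) × RP1}
    {x : ℂ × ℝ} (hx0 : x ≠ 0) (hx : x ∈ q.1.submodule)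
    (hl : ∀ i, x.1 - (x.2 : ℂ) * s i ∈ (q.2.1 i).submodule) (hF : F x ∈ q.2.2.submodule)
    (hP : ∀ i, x.1 = (x.2 : ℂ) * s i →
      ∃ u ≠ 0, u ∈ (q.2.1 i).submodule ∧ polar F (s i, 1) (u, 0) ∈ q.2.2.submodule) :
    q ∈ resolution F s := by
  refine ⟨fun i => mem_projLine_of_mem hx0 hx (hl i), fun i => ?_⟩
  by_cases hi : x.1 = (x.2 : ℂ) * s i
  · obtain ⟨u, hu, hul, hm⟩ := hP i hi
    exact (polar_mem_iff_of_fst_eq hx0 hx hi hu hul).2 hm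
  · intro y hy v hv
    by_cases hy0 : y = 0
    · subst hy0
      have : ((0 : ℂ × ℝ) + (0 : ℂ × ℝ).2 • ((s i, 1) : ℂ × ℝ)) = 0 := by simp
      rw [this, QuadraticMap.polar_zero_left]
      exact Submodule.zero_mem _
    obtain ⟨r, rfl⟩ := exists_smul_of_mem_submodule hx0 hx hy
    have hr : r ≠ 0 := by
      rintro rfl
      exact hy0 (zero_smul _ _)
    have e : (r • x).1 - ((r • x).2 : ℂ) * s i = r • (x.1 - (x.2 : ℂ) * s i) := by
      simp
      ring
    refine h.polar_mem_of_ne ?_ ?_ ?_ hv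
    · rw [e]
      exact smul_ne_zero hr (sub_ne_zero.2 hi)
    · rw [e]
      exact Submodule.smul_mem _ _ (hl i)
    · rw [QuadraticMap.map_smul]
      exact Submodule.smul_mem _ _ hF

/-- Away from s_i the point itself fixes the direction at s_i. At s_i the direction is sent into the
line m by the differential of F, which is injective because the zero is simple. -/
theorem injOn_universalCurve (h : IsSimpleBaseLocus F s) {p : RP2} {l l' : ι → RP1} {m : RP1}
    (hl : (p, l, m) ∈ resolution F s) (hl' : (p, l', m) ∈ resolution F s) : l = l' := by
  funext i
  have hx := p.rep_mem_submodule
  by_cases hi : p.rep.1 = (p.rep.2 : ℂ) * s i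
  · have h1 := (polar_mem_iff_of_fst_eq p.rep_nonzero hx hi (l i).rep_nonzero
      (l i).rep_mem_submodule).1 (hl.2 i)
    have h2 := (polar_mem_iff_of_fst_eq p.rep_nonzero hx hi (l' i).rep_nonzero
      (l' i).rep_mem_submodule).1 (hl'.2 i)
    obtain ⟨r, hr⟩ := exists_smul_of_mem_submodule
      (h.polar_ne_zero i _ (l' i).rep_nonzero) h2 h1
    have h3 : (l i).rep - r • (l' i).rep = 0 := by
      by_contra hne
      refine h.polar_ne_zero i _ hne ?_
      have e2 : (((l i).rep - r • (l' i).rep, 0) : ℂ × ℝ) =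
        ((l i).rep, 0) - r • ((l' i).rep, 0) := by simp
      rw [e2, QuadraticMap.polar_sub_right, QuadraticMap.polar_smul_right, hr, sub_self]
    refine eq_of_mem_submodule (l i).rep_nonzero (l i).rep_mem_submodule ?_
    rw [sub_eq_zero.1 h3]
    exact Submodule.smul_mem _ _ (l' i).rep_mem_submodule
  · exact eq_of_mem_submodule (sub_ne_zero.2 hi) (hl.1 i _ hx) (hl'.1 i _ hx)

theorem exists_mem_resolution_of_universalCurve (h : IsSimpleBaseLocus F s) {p : RP2} {m : RP1}
    (hpm : (p, m) ∈ universalCurve (pencil F)) : ∃ l, (p, l, m) ∈ resolution F s := by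
  have hx := p.rep_mem_submodule
  have hF := mem_universalCurve_pencil.1 hpm
  have key : ∀ i, ∃ l : RP1, p.rep.1 - (p.rep.2 : ℂ) * s i ∈ l.submodule ∧
      (p.rep.1 = (p.rep.2 : ℂ) * s i →
        ∃ u ≠ 0, u ∈ l.submodule ∧ polar F (s i, 1) (u, 0) ∈ m.submodule) := by
    intro i
    by_cases hi : p.rep.1 = (p.rep.2 : ℂ) * s i
    · obtain ⟨u, hu⟩ := h.exists_polar_eq i m.rep
      have hu0 : u ≠ 0 := by
        rintro rfl
        refine m.rep_nonzero ?_
        rw [← hu]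
        exact QuadraticMap.polar_zero_right _ _
      refine ⟨Projectivization.mk ℝ u hu0, ?_, fun _ => ⟨u, hu0, self_mem_submodule_mk _ _, ?_⟩⟩
      · rw [sub_eq_zero.2 hi]
        exact Submodule.zero_mem _
      · rw [hu]
        exact m.rep_mem_submodule
    · exact ⟨Projectivization.mk ℝ _ (sub_ne_zero.2 hi), self_mem_submodule_mk _ _, fun h' => absurd h' hi⟩
  choose l hl hl' using key
  exact ⟨l, h.mem_resolution_of_mem p.rep_nonzero hx hl (hF _ hx) hl'⟩

/-- The line m is spanned by F(p) if this is nonzero, and otherwise by the image of the direction at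
the base point under the differential of F. -/
theorem injOn_blowUp [Nonempty ι] (h : IsSimpleBaseLocus F s) {p : RP2} {l : ι → RP1}
    {m m' : RP1} (hm : (p, l, m) ∈ resolution F s) (hm' : (p, l, m') ∈ resolution F s) :
    m = m' := by
  have hx := p.rep_mem_submodule
  by_cases hF : F p.rep = 0
  · obtain ⟨i, hi⟩ := h.exists_eq _ p.rep_nonzero hF
    exact eq_of_mem_submodule (h.polar_ne_zero i _ (l i).rep_nonzero)
      ((polar_mem_iff_of_fst_eq p.rep_nonzero hx hi (l i).rep_nonzero (l i).rep_mem_submodule).1 (hm.2 i))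
      ((polar_mem_iff_of_fst_eq p.rep_nonzero hx hi (l i).rep_nonzero (l i).rep_mem_submodule).1 (hm'.2 i))
  · exact eq_of_mem_submodule hF (h.map_mem_of_mem_resolution hm hx)
      (h.map_mem_of_mem_resolution hm' hx)

theorem exists_mem_resolution_of_blowUp (h : IsSimpleBaseLocus F s) {p : RP2} {l : ι → RP1}
    (hpl : (p, l) ∈ blowUp s) : ∃ m, (p, l, m) ∈ resolution F s := by
  have hx := p.rep_mem_submodule
  by_cases hF : F p.rep = 0
  · obtain ⟨i, hi⟩ := h.exists_eq _ p.rep_nonzero hF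
    refine ⟨Projectivization.mk ℝ _ (h.polar_ne_zero i _ (l i).rep_nonzero),
      h.mem_resolution_of_mem p.rep_nonzero hx (fun j => hpl j _ hx) ?_ fun j hj => ?_⟩
    · rw [hF]
      exact Submodule.zero_mem _
    · obtain rfl : i = j := by
        by_contra hij
        exact fst_sub_smul_ne_zero (fun e => hij (h.injective e).symm) p.rep_nonzero hi
          (sub_eq_zero.2 hj)
      exact ⟨_, (l i).rep_nonzero, (l i).rep_mem_submodule, self_mem_submodule_mk _ _⟩
  · refine ⟨Projectivization.mk ℝ _ hF, h.mem_resolution_of_mem p.rep_nonzero hx (fun j => hpl j _ hx)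
      (self_mem_submodule_mk _ _) fun j hj => absurd ?_ hF⟩
    have h1 : p.rep = p.rep.2 • ((s j, 1) : ℂ × ℝ) := by
      ext1
      · simpa using hj
      · simp
    rw [h1, QuadraticMap.map_smul, h.map_base j, smul_zero]

theorem exists_homeomorph_universalCurve [Finite ι] [Nonempty ι] (h : IsSimpleBaseLocus F s) :
    ∃ e : resolution F s ≃ₜ universalCurve (pencil F), ∀ q, (e q : RP2 × RP1) =
      ((q : RP2 × (ι → RP1) × RP1).1, (q : RP2 × (ι → RP1) × RP1).2.2) := by
  have := isCompact_iff_compactSpace.1 h.isCompact_resolution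
  refine exists_homeomorph_of_range_eq (X := resolution F s) (by fun_prop) ?_ ?_
  · rintro ⟨⟨p, l, m⟩, hq⟩ ⟨⟨p', l', m'⟩, hq'⟩ e
    obtain ⟨rfl, rfl⟩ := Prod.ext_iff.1 e
    obtain rfl := h.injOn_universalCurve hq hq'
    rfl
  · ext ⟨p, m⟩
    constructor
    · rintro ⟨q, hq⟩
      rw [← hq]
      exact mem_universalCurve_pencil.2 fun x hx => h.map_mem_of_mem_resolution q.2 hx
    · intro hpm
      obtain ⟨l, hl⟩ := h.exists_mem_resolution_of_universalCurve hpm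
      exact ⟨⟨_, hl⟩, rfl⟩

theorem exists_homeomorph_blowUp [Finite ι] [Nonempty ι] (h : IsSimpleBaseLocus F s) :
    ∃ e : resolution F s ≃ₜ blowUp s, ∀ q, (e q : RP2 × (ι → RP1)) =
      ((q : RP2 × (ι → RP1) × RP1).1, (q : RP2 × (ι → RP1) × RP1).2.1) := by
  have := isCompact_iff_compactSpace.1 h.isCompact_resolution
  refine exists_homeomorph_of_range_eq (X := resolution F s) (by fun_prop) ?_ ?_
  · rintro ⟨⟨p, l, m⟩, hq⟩ ⟨⟨p', l', m'⟩, hq'⟩ e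
    obtain ⟨rfl, rfl⟩ := Prod.ext_iff.1 e
    obtain rfl := h.injOn_blowUp hq hq'
    rfl
  · ext ⟨p, l⟩
    constructor
    · rintro ⟨q, hq⟩
      rw [← hq]
      exact q.2.1
    · intro hpl
      obtain ⟨m, hm⟩ := h.exists_mem_resolution_of_blowUp hpl
      exact ⟨⟨_, hm⟩, rfl⟩

theorem injective_pencil [Nonempty ι] (h : IsSimpleBaseLocus F s) :
    Function.Injective (pencil F) := by
  rw [← LinearMap.ker_eq_bot, LinearMap.ker_eq_bot']
  intro v hv
  obtain ⟨i⟩ := ‹Nonempty ι›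
  -- If the form of v vanishes, so does its polar form; evaluated at this u it equals Im(i v conj v)
  -- = |v|².
  obtain ⟨u, hu⟩ := h.exists_polar_eq i (Complex.I * v)
  have h1 : ∀ x, (F x * star v).im = 0 := fun x => by
    rw [← pencil_apply, hv, zero_apply]
  have h2 : (polar F (s i, 1) (u, 0) * star v).im = 0 := by
    unfold polar
    rw [sub_mul, sub_mul, Complex.sub_im, Complex.sub_im, h1, h1, h1]
    norm_num
  rw [hu] at h2
  have h3 : v.re * v.re + v.im * v.im = 0 := by
    simpa [add_comm] using h2
  exact Complex.normSq_eq_zero.1 h3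

theorem iInter_conic_pencil (h : IsSimpleBaseLocus F s) :
    (⋂ v : ℂ, conic (pencil F v)) = Set.range fun i => affinePoint (s i) := by
  ext p
  simp only [Set.mem_iInter, Set.mem_range]
  constructor
  · intro hp
    have hF : F p.rep = 0 := by
      have h1 := hp 1 _ p.rep_mem_submodule
      have h2 := hp Complex.I _ p.rep_mem_submodule
      rw [pencil_apply] at h1 h2
      apply Complex.ext
      · simpa using h2
      · simpa using h1
    obtain ⟨i, hi⟩ := h.exists_eq _ p.rep_nonzero hF
    refine ⟨i, eq_of_mem_submodule p.rep_nonzero (mem_submodule_mk.2 ⟨p.rep.2, ?_⟩)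
      p.rep_mem_submodule⟩
    ext1
    · simpa using hi.symm
    · simp
  · rintro ⟨i, rfl⟩ v x hx
    obtain ⟨r, rfl⟩ := mem_submodule_mk.1 hx
    rw [pencil_apply, QuadraticMap.map_smul, h.map_base, smul_zero, zero_mul, Complex.zero_im]

end IsSimpleBaseLocus

/-! ### Critical points and critical values -/

theorem self_mem_submodule_twoArg (z : ℂ) (hz : z ≠ 0) : z ∈ (twoArg z).submodule := by
  rw [twoArg, dif_pos hz]
  exact self_mem_submodule_mk _ _

theorem slopeChart_twoArg (z : ℂ) {u : ℂ} (hu : u ≠ 0) :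
    slopeChart z (twoArg u) = (u / z).im / (u / z).re := by
  obtain ⟨r, hr⟩ := exists_smul_of_mem_submodule hu (self_mem_submodule_twoArg u hu)
    (twoArg u).rep_mem_submodule
  have hr0 : r ≠ 0 := by
    rintro rfl
    exact (twoArg u).rep_nonzero (by rw [hr, zero_smul])
  rw [slopeChart, hr, smul_div_assoc, Complex.smul_im, Complex.smul_re, smul_eq_mul, smul_eq_mul,
    mul_div_mul_left _ _ hr0]

/-- Near 0 the function is Im(u/z) / (1 + Re(u/z)), whose linear part is Im(u/z). -/
theorem hasFDerivAt_slopeChart {z : ℂ} (hz : z ≠ 0) :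
    HasFDerivAt (fun u : ℂ => slopeChart z (twoArg (z + u)))
      (Complex.imCLM ∘L (ContinuousLinearMap.mul ℝ ℂ z⁻¹)) 0 := by
  set T : ℂ →L[ℝ] ℂ := ContinuousLinearMap.mul ℝ ℂ z⁻¹ with hT
  have h1 : HasFDerivAt (fun u : ℂ => (T u).im) (Complex.imCLM ∘L T) 0 :=
    (Complex.imCLM ∘L T).hasFDerivAt
  have h2 : HasFDerivAt (fun u : ℂ => 1 + (T u).re) (Complex.reCLM ∘L T) 0 :=
    (Complex.reCLM ∘L T).hasFDerivAt.const_add 1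
  have h3 := h1.mul ((hasDerivAt_inv (by simp)).comp_hasFDerivAt 0 h2)
  simp only [map_zero, Complex.zero_re, Complex.zero_im, Function.comp_apply, add_zero, one_smul,
    zero_smul, zero_add, inv_one] at h3
  refine h3.congr_of_eventuallyEq ?_
  have h4 : ∀ᶠ u : ℂ in nhds 0, z + u ≠ 0 :=
    (continuous_const.add continuous_id).continuousAt.eventually_ne (by simpa using hz)
  filter_upwards [h4] with u hu
  have h5 : (z + u) / z = 1 + T u := by
    rw [hT, ContinuousLinearMap.mul_apply']
    field_simp
  rw [slopeChart_twoArg z hu, h5]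
  simp [div_eq_mul_inv]

/-- In the charts the differential is w ↦ Im(w_i / v_i), between real spaces of dimension 4. It
therefore fails to be surjective exactly when it has a kernel. -/
theorem isCriticalPoint_iff {V : AffineSubspace ℂ (Fin 4 → ℂ)}
    (hV : Module.finrank ℂ V.direction = 2) {v : Fin 4 → ℂ} :
    IsCriticalPoint V v ↔ v ∈ V ∧ (∀ i, v i ≠ 0) ∧
      ∃ w ∈ V.direction, w ≠ 0 ∧ ∀ i, (w i * star (v i)).im = 0 := by
  refine and_congr_right fun _ => and_congr_right fun hv => ?_
  let L : V.direction →L[ℝ] (Fin 4 → ℝ) := ContinuousLinearMap.pi fun i =>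
    (Complex.imCLM ∘L (ContinuousLinearMap.mul ℝ ℂ (v i)⁻¹)) ∘L
      ((ContinuousLinearMap.proj i : (Fin 4 → ℂ) →L[ℝ] ℂ) ∘L
        (V.direction.subtypeL.restrictScalars ℝ))
  have hL : HasFDerivAt (fun (w : V.direction) (i : Fin 4) =>
        slopeChart (v i) (twoArg (v i + (w : Fin 4 → ℂ) i))) L 0 := by
    refine hasFDerivAt_pi.2 fun i => ?_
    have h1 := hasFDerivAt_slopeChart (hv i)
    exact HasFDerivAt.comp (0 : V.direction) (f := fun w : V.direction => (w : Fin 4 → ℂ) i)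
      (g := fun u : ℂ => slopeChart (v i) (twoArg (v i + u))) h1
      ((ContinuousLinearMap.proj i : (Fin 4 → ℂ) →L[ℝ] ℂ) ∘L
        (V.direction.subtypeL.restrictScalars ℝ)).hasFDerivAt
  rw [hL.fderiv]
  have hdim : Module.finrank ℝ V.direction = Module.finrank ℝ (Fin 4 → ℝ) := by
    rw [finrank_real_of_complex, hV]
    simp
  have : FiniteDimensional ℝ V.direction := FiniteDimensional.complexToReal _
  have hinj := LinearMap.injective_iff_surjective_of_finrank_eq_finrank hdim
    (f := (L : V.direction →ₗ[ℝ] (Fin 4 → ℝ)))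
  have hL0 : ∀ w : V.direction, L w = 0 ↔ ∀ i, ((w : Fin 4 → ℂ) i * star (v i)).im = 0 := by
    intro w
    rw [funext_iff]
    refine forall_congr' fun i => ?_
    have h1 : L w i = ((v i)⁻¹ * (w : Fin 4 → ℂ) i).im := rfl
    have h2 : Complex.normSq (v i) ≠ 0 := by simpa using hv i
    have h3 : ((v i)⁻¹ * (w : Fin 4 → ℂ) i).im =
        ((w : Fin 4 → ℂ) i * star (v i)).im * (Complex.normSq (v i))⁻¹ := by
      rw [Complex.inv_def, mul_right_comm, mul_comm _ ((w : Fin 4 → ℂ) i), Complex.im_mul_ofReal]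
      rfl
    rw [h1, h3]
    simp [hv i]
  have hS : Function.Surjective L ↔ ∀ w, L w = 0 → w = 0 := by
    rw [← LinearMap.ker_eq_bot, LinearMap.ker_eq_bot'] at hinj
    exact hinj.symm
  rw [hS]
  push Not
  constructor
  · rintro ⟨w, h1, h2⟩
    exact ⟨w, w.2, fun h => h2 (Subtype.ext h), (hL0 w).1 h1⟩
  · rintro ⟨w, hw, h1, h2⟩
    exact ⟨⟨w, hw⟩, (hL0 _).2 h2, fun h => h1 (congrArg Subtype.val h)⟩

theorem twoArg_eq_of_mem {l : RP1} {z : ℂ} (hz : z ≠ 0) (h : z ∈ l.submodule) : twoArg z = l :=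
  eq_of_mem_submodule hz (self_mem_submodule_twoArg z hz) h

theorem mem_criticalValues_iff {V : AffineSubspace ℂ (Fin 4 → ℂ)}
    (hV : Module.finrank ℂ V.direction = 2) {l : Fin 4 → RP1} :
    l ∈ criticalValues V ↔ ∃ v ∈ V, (∀ i, v i ≠ 0) ∧ (∀ i, v i ∈ (l i).submodule) ∧
      ∃ w ∈ V.direction, w ≠ 0 ∧ ∀ i, w i ∈ (l i).submodule := by
  constructor
  · rintro ⟨v, hv, rfl⟩
    obtain ⟨h1, h2, w, hw, hw0, h3⟩ := (isCriticalPoint_iff hV).1 hv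
    exact ⟨v, h1, h2, fun i => self_mem_submodule_twoArg _ (h2 i), w, hw, hw0, fun i =>
      mem_submodule_of_im_mul_star_eq_zero (h2 i) (self_mem_submodule_twoArg _ (h2 i)) (h3 i)⟩
  · rintro ⟨v, h1, h2, h3, w, hw, hw0, h4⟩
    refine ⟨v, (isCriticalPoint_iff hV).2 ⟨h1, h2, w, hw, hw0, fun i =>
      im_mul_star_eq_zero_of_mem (h3 i) (h4 i)⟩, funext fun i => ?_⟩
    exact (twoArg_eq_of_mem (h2 i) (h3 i)).symm

theorem smul_mem_criticalValues {V W : AffineSubspace ℂ (Fin 4 → ℂ)}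
    (hV : Module.finrank ℂ V.direction = 2) (hW : Module.finrank ℂ W.direction = 2)
    {c : Fin 4 → ℂˣ} (h : ∀ v ∈ V, c • v ∈ W) {l : Fin 4 → RP1} (hl : l ∈ criticalValues V) :
    (fun i => c i • l i) ∈ criticalValues W := by
  obtain ⟨v, h1, h2, h3, w, hw, hw0, h4⟩ := (mem_criticalValues_iff hV).1 hl
  refine (mem_criticalValues_iff hW).2 ⟨c • v, h v h1, fun i => ?_, fun i =>
    smul_mem_submodule_smul (c i) (h3 i), c • w, ?_, ?_, fun i =>
    smul_mem_submodule_smul (c i) (h4 i)⟩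
  · exact (smul_ne_zero_iff_ne (c i)).2 (h2 i)
  · rw [← AffineSubspace.vadd_mem_iff_mem_direction _ (h v h1), vadd_eq_add, ← smul_add]
    exact h _ (AffineSubspace.vadd_mem_of_mem_direction hw h1)
  · exact (smul_ne_zero_iff_ne c).2 hw0

theorem mem_planeOf {M : Matrix (Fin 4) (Fin 3) ℂ} {v : Fin 4 → ℂ} :
    v ∈ planeOf M ↔ ∃ s t : ℂ, ∀ i, v i = M i 0 * s + M i 1 * t + M i 2 := by
  rw [planeOf, AffineSubspace.mem_mk', Submodule.mem_span_pair]
  refine exists_congr fun s => exists_congr fun t => ?_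
  rw [funext_iff]
  refine forall_congr' fun i => ?_
  simp only [Pi.add_apply, Pi.smul_apply, smul_eq_mul, vsub_eq_sub, Pi.sub_apply]
  rw [eq_sub_iff_add_eq, mul_comm s, mul_comm t, eq_comm]

theorem mem_direction_planeOf {M : Matrix (Fin 4) (Fin 3) ℂ} {v : Fin 4 → ℂ} :
    v ∈ (planeOf M).direction ↔ ∃ s t : ℂ, ∀ i, v i = M i 0 * s + M i 1 * t := by
  rw [planeOf, AffineSubspace.direction_mk', Submodule.mem_span_pair]
  refine exists_congr fun s => exists_congr fun t => ?_
  rw [funext_iff]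
  refine forall_congr' fun i => ?_
  simp only [Pi.add_apply, Pi.smul_apply, smul_eq_mul]
  rw [mul_comm s, mul_comm t, eq_comm]

theorem finrank_direction_planeOf {M : Matrix (Fin 4) (Fin 3) ℂ}
    (h : M 0 0 * M 1 1 - M 0 1 * M 1 0 ≠ 0) : Module.finrank ℂ (planeOf M).direction = 2 := by
  have h1 : LinearIndependent ℂ ![fun i => M i 0, fun i => M i 1] := by
    refine LinearIndependent.pair_iff.2 fun s t hst => ?_
    have h0 := congrFun hst 0
    have h1 := congrFun hst 1
    simp only [Pi.add_apply, Pi.smul_apply, smul_eq_mul, Pi.zero_apply] at h0 h1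
    constructor
    · refine (mul_eq_zero.1 (?_ : s * _ = 0)).resolve_right h
      linear_combination M 1 1 * h0 - M 0 1 * h1
    · refine (mul_eq_zero.1 (?_ : t * _ = 0)).resolve_right h
      linear_combination M 0 0 * h1 - M 1 0 * h0
  have h2 := finrank_span_eq_card h1
  rw [planeOf, AffineSubspace.direction_mk']
  rw [Matrix.range_cons, Matrix.range_cons, Matrix.range_empty, Set.union_empty] at h2
  exact h2

theorem finrank_direction_normalPlane (a k : ℂ) :
    Module.finrank ℂ (normalPlane a k).direction = 2 :=
  finrank_direction_planeOf (by simp)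

theorem mem_criticalValues_normalPlane {a k : ℂ} {l : Fin 4 → RP1} :
    l ∈ criticalValues (normalPlane a k) ↔ ∃ x y ξ η : ℂ,
      (x ≠ 0 ∧ y ≠ 0 ∧ x + y - 1 ≠ 0 ∧ x + k * y - a ≠ 0) ∧
      (x ∈ (l 0).submodule ∧ y ∈ (l 1).submodule ∧ x + y - 1 ∈ (l 2).submodule ∧
        x + k * y - a ∈ (l 3).submodule) ∧
      (ξ ≠ 0 ∨ η ≠ 0) ∧ (ξ ∈ (l 0).submodule ∧ η ∈ (l 1).submodule ∧ ξ + η ∈ (l 2).submodule ∧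
        ξ + k * η ∈ (l 3).submodule) := by
  rw [mem_criticalValues_iff (finrank_direction_normalPlane a k)]
  constructor
  · rintro ⟨v, hv, h1, h2, w, hw, hw0, h3⟩
    obtain ⟨x, y, hv⟩ := mem_planeOf.1 hv
    obtain ⟨ξ, η, hw⟩ := mem_direction_planeOf.1 hw
    simp [Fin.forall_fin_succ] at hv hw h1 h2 h3
    rw [← sub_eq_add_neg] at hv
    rw [← sub_eq_add_neg] at hv
    refine ⟨x, y, ξ, η, ?_, ?_, ?_, ?_⟩
    · simpa [hv] using h1
    · simpa [hv] using h2
    · by_contra! h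
      refine hw0 (funext fun i => ?_)
      fin_cases i <;> simp [hw, h]
    · simpa [hw] using h3
  · rintro ⟨x, y, ξ, η, h1, h2, h0, h3⟩
    refine ⟨![x, y, x + y - 1, x + k * y - a], mem_planeOf.2 ⟨x, y, ?_⟩, ?_, ?_,
      ![ξ, η, ξ + η, ξ + k * η], mem_direction_planeOf.2 ⟨ξ, η, ?_⟩, ?_, ?_⟩
    · simp [Fin.forall_fin_succ, sub_eq_add_neg]
    · simpa [Fin.forall_fin_succ] using h1
    · simpa [Fin.forall_fin_succ] using h2
    · simp [Fin.forall_fin_succ]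
    · intro h
      have e0 := congrFun h 0
      have e1 := congrFun h 1
      simp at e0 e1
      simp [e0, e1] at h0
    · simpa [Fin.forall_fin_succ] using h3

/-! ### The conic pencil of a plane in normal form and its base points -/

/-- The pencil of conics attached to the plane `normalPlane a k`. -/
noncomputable def conicMap (a k : ℂ) : QuadraticMap ℝ (ℂ × ℝ) ℂ :=
  let fst : ℂ × ℝ →ₗ[ℝ] ℂ := LinearMap.fst ℝ ℂ ℝ
  let snd : ℂ × ℝ →ₗ[ℝ] ℂ := Complex.ofRealCLM.toLinearMap ∘ₗ LinearMap.snd ℝ ℂ ℝ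
  let im : ℂ →ₗ[ℝ] ℂ := Complex.ofRealCLM.toLinearMap ∘ₗ Complex.imLm
  QuadraticMap.linMulLin (im ∘ₗ fst)
      (LinearMap.mulLeft ℝ (star k) ∘ₗ (fst - LinearMap.mulRight ℝ a ∘ₗ snd)) -
    QuadraticMap.linMulLin (im ∘ₗ LinearMap.mulRight ℝ (star a) ∘ₗ fst) (fst - snd)

theorem conicMap_apply (a k : ℂ) (x : ℂ × ℝ) :
    conicMap a k x = x.1.im * (star k * (x.1 - x.2 * a)) - (x.1 * star a).im * (x.1 - x.2) := rfl

theorem polar_conicMap (a k s v : ℂ) :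
    polar (conicMap a k) (s, 1) (v, 0) =
      v.im * (star k * (s - a)) + s.im * (star k * v) - (v * star a).im * (s - 1) -
        (s * star a).im * v := by
  simp only [polar, conicMap_apply, Prod.fst_add, Prod.snd_add, add_mul, Complex.add_im]
  push_cast
  ring

/-- The base point of the pencil `conicMap a k` other than `0`, `1`, `a`. -/
noncomputable def fourthPoint (a k : ℂ) : ℂ :=
  let t : ℝ := (a * star a * star k + k * star k * a + star a * k).im / (star k * a + star a + k).im
  (star k * a - t) / (star k - t)

/-- The determinant of `v ↦ polar (conicMap a k) (s, 1) (v, 0)`. -/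
noncomputable def polarDet (a k s : ℂ) : ℝ :=
  (star (polar (conicMap a k) (s, 1) (1, 0)) * polar (conicMap a k) (s, 1) (Complex.I, 0)).im

/-- The conditions of general position on the plane `normalPlane a k`. -/
structure IsGeneral (a k : ℂ) : Prop where
  im_a : a.im ≠ 0
  im_k : k.im ≠ 0
  im_ka : (k * star a).im ≠ 0
  im_one_sub : ((1 - k) * (1 - star a)).im ≠ 0
  im_a_mul : (a * (k - 1) * star k * (star a - 1)).im ≠ 0
  fourth : (star k * a + star a + k).im ≠ 0
  fourth_ne_zero : fourthPoint a k ≠ 0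
  fourth_ne_one : fourthPoint a k ≠ 1
  fourth_ne_a : fourthPoint a k ≠ a
  polar_zero : polarDet a k 0 ≠ 0
  polar_one : polarDet a k 1 ≠ 0
  polar_a : polarDet a k a ≠ 0
  polar_fourth : polarDet a k (fourthPoint a k) ≠ 0

theorem polar_ne_zero_of_polarDet_ne_zero {a k s v : ℂ} (h : polarDet a k s ≠ 0) (hv : v ≠ 0) :
    polar (conicMap a k) (s, 1) (v, 0) ≠ 0 := by
  intro h0
  have e : ((v, 0) : ℂ × ℝ) = v.re • (1, 0) + v.im • (Complex.I, 0) := by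
    simp
  rw [e, QuadraticMap.polar_add_right, QuadraticMap.polar_smul_right,
    QuadraticMap.polar_smul_right] at h0
  unfold polarDet at h
  generalize polar (conicMap a k) (s, 1) (1, 0) = u at *
  generalize polar (conicMap a k) (s, 1) (Complex.I, 0) = w at *
  simp [Complex.ext_iff] at h0 h
  obtain ⟨h1, h2⟩ := h0
  have e1 : v.re = 0 := by
    refine (mul_eq_zero.1 (?_ : v.re * _ = 0)).resolve_right h
    linear_combination w.im * h1 - w.re * h2
  have e2 : v.im = 0 := by
    refine (mul_eq_zero.1 (?_ : v.im * _ = 0)).resolve_right h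
    linear_combination u.re * h2 - u.im * h1
  exact hv (Complex.ext e1 e2)

namespace IsGeneral

variable {a k : ℂ}

theorem injective (h : IsGeneral a k) :
    Function.Injective (![0, 1, a, fourthPoint a k] : Fin 4 → ℂ) := by
  have h0 : a ≠ 0 := fun e => h.im_a (by simp [e])
  have h1 : a ≠ 1 := fun e => h.im_a (by simp [e])
  have h2 := h.fourth_ne_zero
  have h3 := h.fourth_ne_one
  have h4 := h.fourth_ne_a
  intro i j hij
  fin_cases i <;> fin_cases j <;> simp_all [eq_comm]

theorem star_sub_ofReal_ne_zero (h : IsGeneral a k) (t : ℝ) : star k - (t : ℂ) ≠ 0 := by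
  intro e
  have := congrArg Complex.im e
  simp at this
  exact h.im_k this

theorem conicMap_fourthPoint (h : IsGeneral a k) : conicMap a k (fourthPoint a k, 1) = 0 := by
  set d := fourthPoint a k with hd
  have hD := h.fourth
  have hkt := h.star_sub_ofReal_ne_zero
  obtain ⟨t, ht, hdt⟩ : ∃ t : ℝ, t * (star k * a + star a + k).im =
      (a * star a * star k + k * star k * a + star a * k).im ∧
      d * (star k - t) = star k * a - t :=
    ⟨_, div_mul_cancel₀ _ hD, div_mul_cancel₀ _ (hkt _)⟩
  have h1 : d * ((star k - t) * star (star k - t)) = (star k * a - t) * star (star k - t) := by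
    rw [← mul_assoc, hdt]
  have h2 : Complex.normSq (star k - t) ≠ 0 := by simpa using hkt t
  have h3 : (d * (star a - t)).im = 0 := by
    have h4 : d * (Complex.normSq (star k - t) : ℂ) = (star k * a - t) * star (star k - t) := by
      rw [← h1, ← Complex.mul_conj]
      rfl
    have h5 : (d * (star a - t)).im * Complex.normSq (star k - t) =
        ((star k * a - t) * star (star k - t) * (star a - t)).im := by
      rw [← h4, ← Complex.im_mul_ofReal]
      ring_nf
    refine (mul_eq_zero.1 (h5.trans ?_)).resolve_right h2
    simp at ht ⊢
    linear_combination t * ht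
  have h4 : (d * star a).im = t * d.im := by
    rw [mul_sub, Complex.sub_im, Complex.im_mul_ofReal] at h3
    linear_combination h3
  rw [conicMap_apply]
  simp only [h4]
  push_cast
  linear_combination (d.im : ℂ) * hdt

/-- Zeros with Im z = 0 are 0 and 1, and the remaining ones with Im(z conj a) = 0 give a. Otherwise
put t = Im(z conj a) / Im z. Then F = 0 gives z(conj k - t) = w(conj k · a - t), and Im(z(conj a -
t)) = 0 becomes Im((conj k · a - t)(k - t)(conj a - t)) = 0. The terms of degree 0 and 3 in t are
real, so dividing by t leaves a linear equation, whose root is the t of `fourthPoint`. -/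
theorem exists_eq (h : IsGeneral a k) {x : ℂ × ℝ} (hx : x ≠ 0) (hF : conicMap a k x = 0) :
    ∃ i, x.1 = (x.2 : ℂ) * (![0, 1, a, fourthPoint a k] : Fin 4 → ℂ) i := by
  obtain ⟨z, w⟩ := x
  rw [conicMap_apply] at hF
  simp only at hF ⊢
  have ha := h.im_a
  by_cases h1 : z.im = 0
  · rw [h1, Complex.ofReal_zero, zero_mul, zero_sub, neg_eq_zero, mul_eq_zero] at hF
    rcases hF with h2 | h2
    · refine ⟨0, ?_⟩
      have h3 : z.re = 0 := by
        simpa [h1, ha] using h2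
      simp [Complex.ext_iff, h1, h3]
    · exact ⟨1, by simpa using sub_eq_zero.1 h2⟩
  by_cases h2 : (z * star a).im = 0
  · refine ⟨2, ?_⟩
    have hk : k ≠ 0 := by simpa using h.star_sub_ofReal_ne_zero 0
    rw [h2] at hF
    simpa [h1, hk, sub_eq_zero] using hF
  refine ⟨3, ?_⟩
  have h1' : (z.im : ℂ) ≠ 0 := by exact_mod_cast h1
  set t : ℝ := (z * star a).im / z.im with ht
  have ht1 : (z * star a).im = t * z.im := (div_mul_cancel₀ _ h1).symm
  have ht0 : t ≠ 0 := div_ne_zero h2 h1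
  have e1 : star k * (z - w * a) = t * (z - w) := by
    rw [ht1] at hF
    refine mul_left_cancel₀ h1' ?_
    push_cast at hF
    linear_combination hF
  have e2 : z * (star k - t) = w * (star k * a - t) := by linear_combination e1
  have hkt := h.star_sub_ofReal_ne_zero t
  have hw : w ≠ 0 := by
    rintro rfl
    rw [Complex.ofReal_zero, zero_mul, mul_eq_zero] at e2
    refine hkt (e2.resolve_left ?_)
    rintro rfl
    exact h1 rfl
  have e3 : (z * (star a - t)).im = 0 := by
    rw [mul_sub, Complex.sub_im, Complex.im_mul_ofReal, ht1]
    ring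
  have e4 : (w * (star k * a - t) * star (star k - t) * (star a - t)).im = 0 := by
    have : (w * (star k * a - t) * star (star k - t) * (star a - t)) =
        z * (star a - t) * (Complex.normSq (star k - t) : ℂ) := by
      rw [← e2, ← Complex.mul_conj]
      simp only [← Complex.star_def]
      ring
    rw [this, Complex.im_mul_ofReal, e3, zero_mul]
  have e5 : t * (star k * a + star a + k).im =
      (a * star a * star k + k * star k * a + star a * k).im := by
    refine mul_left_cancel₀ (mul_ne_zero hw ht0) ?_
    simp [-mul_eq_mul_left_iff] at e4 ⊢
    linear_combination e4
  have e6 : t = (a * star a * star k + k * star k * a + star a * k).im /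
      (star k * a + star a + k).im := (eq_div_iff h.fourth).2 e5
  change z = w * fourthPoint a k
  simp only [fourthPoint, ← e6]
  rw [← mul_div_assoc, eq_div_iff hkt, e2]

theorem isSimpleBaseLocus (h : IsGeneral a k) :
    IsSimpleBaseLocus (conicMap a k) ![0, 1, a, fourthPoint a k] where
  continuous := by
    have : (conicMap a k : ℂ × ℝ → ℂ) = _ := funext (conicMap_apply a k)
    rw [this]
    fun_prop
  injective := h.injective
  map_base i := by
    fin_cases i
    · simp [conicMap_apply]
    · simp [conicMap_apply]
    · simp [conicMap_apply, mul_comm]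
    · exact h.conicMap_fourthPoint
  exists_eq x hx hF := h.exists_eq hx hF
  polar_ne_zero i v hv := by
    fin_cases i
    · exact polar_ne_zero_of_polarDet_ne_zero h.polar_zero hv
    · exact polar_ne_zero_of_polarDet_ne_zero h.polar_one hv
    · exact polar_ne_zero_of_polarDet_ne_zero h.polar_a hv
    · exact polar_ne_zero_of_polarDet_ne_zero h.polar_fourth hv

end IsGeneral

/-- Two distinct common points would make the three lines coincide, so that 0, 1, a would be
collinear. -/
theorem inter_projLine_eq_singleton {a : ℂ} (ha : a.im ≠ 0) {p : RP2} {l₀ l₁ l₂ : RP1}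
    (h₀ : p ∈ projLine 0 l₀) (h₁ : p ∈ projLine 1 l₁) (h₂ : p ∈ projLine a l₂) :
    projLine 0 l₀ ∩ projLine 1 l₁ ∩ projLine a l₂ = {p} := by
  refine Set.eq_singleton_iff_unique_mem.2 ⟨⟨⟨h₀, h₁⟩, h₂⟩, ?_⟩
  rintro q ⟨⟨k₀, k₁⟩, k₂⟩
  have hx := p.rep_mem_submodule
  have hx0 := p.rep_nonzero
  have hy := q.rep_mem_submodule
  have hy0 := q.rep_nonzero
  generalize p.rep = x at *
  generalize q.rep = y at *
  obtain ⟨z, w⟩ := x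
  obtain ⟨z', w'⟩ := y
  have e0 := im_mul_star_eq_zero_of_mem (h₀ _ hx) (k₀ _ hy)
  have e1 := im_mul_star_eq_zero_of_mem (h₁ _ hx) (k₁ _ hy)
  have e2 := im_mul_star_eq_zero_of_mem (h₂ _ hx) (k₂ _ hy)
  simp at e0 e1 e2
  have i1 : w * z'.im = w' * z.im := by linear_combination e0 - e1
  have i2 : w * z'.re = w' * z.re := by
    refine mul_left_cancel₀ ha ?_
    linear_combination a.re * i1 + e2 - e0
  by_cases hw : w = 0
  · subst hw
    have hz : z ≠ 0 := by
      rintro rfl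
      exact hx0 rfl
    have hw' : w' = 0 := by
      by_contra hne
      refine hz (Complex.ext ?_ ?_)
      · simpa [hne] using i2
      · simpa [hne] using i1
    subst hw'
    have h3 : z' ∈ (Projectivization.mk ℝ z hz).submodule := by
      rw [mem_submodule_mk_iff_im_eq_zero]
      simpa using e0
    obtain ⟨r, rfl⟩ := mem_submodule_mk.1 h3
    refine eq_of_mem_submodule hy0 hy ?_
    have := p.submodule.smul_mem r hx
    simpa using this
  · refine eq_of_mem_submodule hy0 hy ?_
    have h3 : ((z', w') : ℂ × ℝ) = (w' / w) • (z, w) := by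
      refine Prod.ext (Complex.ext ?_ ?_) ?_
      · simp only [Prod.smul_fst, Complex.smul_re, smul_eq_mul]
        field_simp
        linear_combination i2
      · simp only [Prod.smul_fst, Complex.smul_im, smul_eq_mul]
        field_simp
        linear_combination i1
      · simp [hw]
    rw [h3]
    exact p.submodule.smul_mem _ hx

/-- Each of the finitely many functions vanishes for at most one real s. -/
theorem exists_real_forall_add_mul_ne_zero {ι : Type*} [Finite ι] (u v : ι → ℂ)
    (h : ∀ i, u i = 0 → v i ≠ 0) : ∃ s : ℝ, ∀ i, u i + s * v i ≠ 0 := by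
  have h1 : (⋃ i, {s : ℝ | u i + s * v i = 0}).Finite := by
    refine Set.finite_iUnion fun i => Set.Subsingleton.finite fun s hs t ht => ?_
    have hs' : u i + s * v i = 0 := hs
    have ht' : u i + t * v i = 0 := ht
    by_cases hv : v i = 0
    · rw [hv, mul_zero, add_zero] at hs'
      exact absurd hv (h i hs')
    · have := mul_right_cancel₀ hv (add_left_cancel (hs'.trans ht'.symm))
      exact_mod_cast this
  obtain ⟨s, hs⟩ := h1.infinite_compl.nonempty
  exact ⟨s, fun i hi => hs (Set.mem_iUnion.2 ⟨i, hi⟩)⟩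

/-! ### From critical values to the resolution -/

namespace IsGeneral

variable {a k : ℂ}

/-- This and the next two lemmas treat the base points 0, 1, a. If p = 0 and ξ = 0, then l_1 is
spanned by 1 and l_a by a, so η and kη lie on these lines and η must vanish. Likewise for ξ + η = 0
at 1 and ξ + kη = 0 at a. -/
theorem eq_zero_of_im_eq_zero (h : IsGeneral a k) {v : ℂ} (h1 : v.im = 0)
    (h2 : (k * v * star a).im = 0) : v = 0 := by
  have h3 := h.im_ka
  refine Complex.ext ?_ h1
  refine (mul_eq_zero.1 (?_ : v.re * _ = 0)).resolve_right h3
  simp [h1, -mul_eq_zero] at h2 ⊢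
  linear_combination h2

theorem eq_zero_of_im_sub_eq_zero (h : IsGeneral a k) {v : ℂ} (h1 : v.im = 0)
    (h2 : ((k * v - v) * star (1 - a)).im = 0) : v = 0 := by
  have h3 := h.im_one_sub
  refine Complex.ext ?_ h1
  refine (mul_eq_zero.1 (?_ : v.re * _ = 0)).resolve_right h3
  simp [h1, -mul_eq_zero] at h2 ⊢
  linear_combination -h2

theorem eq_zero_of_im_mul_eq_zero (h : IsGeneral a k) {v : ℂ} (h1 : (k * v * star a).im = 0)
    (h2 : ((k * v - v) * star (a - 1)).im = 0) : v = 0 := by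
  have ha : a ≠ 0 := fun e => h.im_a (by simp [e])
  have hk : k ≠ 0 := fun e => h.im_k (by simp [e])
  obtain ⟨r, hr⟩ := mem_submodule_mk.1 (mem_submodule_mk_iff_im_eq_zero (hv := ha).2 h1)
  have h3 := h.im_a_mul
  have h4 : r = 0 := by
    refine (mul_eq_zero.1 (?_ : r * _ = 0)).resolve_right h3
    have e : (r : ℂ) * (a * (k - 1) * star k * (star a - 1)) =
        (k * v - v) * star (a - 1) * Complex.normSq k := by
      rw [← Complex.mul_conj, ← Complex.star_def]
      rw [Complex.real_smul] at hr
      rw [star_sub, star_one]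
      linear_combination (k - 1) * star k * (star a - 1) * hr
    rw [← Complex.im_ofReal_mul, e, Complex.im_mul_ofReal, h2, zero_mul]
  rw [h4, zero_smul] at hr
  exact (mul_eq_zero.1 hr.symm).resolve_left hk

/-- The direction at the fourth base point does not occur in l. It is taken from a lift of the point
of the universal curve, so compatibility has to be supplied only at 0, 1 and a. -/
theorem exists_mem_resolution_of_map_mem (h : IsGeneral a k) {l : Fin 4 → RP1} {x : ℂ × ℝ}
    (hx : x ≠ 0) (h0 : x.1 ∈ (l 0).submodule) (h1 : x.1 - x.2 ∈ (l 2).submodule)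
    (ha : x.1 - x.2 * a ∈ (l 3).submodule) (hF : conicMap a k x ∈ (l 1).submodule)
    (P0 : x.1 = 0 → ∃ u ≠ 0, u ∈ (l 0).submodule ∧
      polar (conicMap a k) (0, 1) (u, 0) ∈ (l 1).submodule)
    (P1 : x.1 = x.2 → ∃ u ≠ 0, u ∈ (l 2).submodule ∧
      polar (conicMap a k) (1, 1) (u, 0) ∈ (l 1).submodule)
    (Pa : x.1 = x.2 * a → ∃ u ≠ 0, u ∈ (l 3).submodule ∧
      polar (conicMap a k) (a, 1) (u, 0) ∈ (l 1).submodule) :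
    ∃ q ∈ resolution (conicMap a k) ![0, 1, a, fourthPoint a k],
      ![q.2.1 0, q.2.2, q.2.1 1, q.2.1 2] = l := by
  have hxp := self_mem_submodule_mk (K := ℝ) x hx
  obtain ⟨m, hm⟩ := h.isSimpleBaseLocus.exists_mem_resolution_of_universalCurve
    (mem_universalCurve_pencil_of_mem hx hxp hF)
  refine ⟨(Projectivization.mk ℝ x hx, ![l 0, l 2, l 3, m 3], l 1),
    h.isSimpleBaseLocus.mem_resolution_of_mem hx hxp ?_ hF ?_, ?_⟩
  · have h3 := hm.1 3 x hxp
    intro i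
    fin_cases i
    · simpa using h0
    · simpa using h1
    · exact ha
    · exact h3
  · intro i hi
    fin_cases i
    · exact P0 (by simpa using hi)
    · exact P1 (by simpa using hi)
    · exact Pa hi
    · exact ⟨_, (m 3).rep_nonzero, (m 3).rep_mem_submodule, (polar_mem_iff_of_fst_eq hx hxp hi
        (m 3).rep_nonzero (m 3).rep_mem_submodule).1 (hm.2 3)⟩
  · funext i
    fin_cases i <;> rfl

theorem exists_mem_resolution_of_criticalValue (h : IsGeneral a k) {l : Fin 4 → RP1}
    (hl : l ∈ criticalValues (normalPlane a k)) :
    ∃ q ∈ resolution (conicMap a k) ![0, 1, a, fourthPoint a k],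
      ![q.2.1 0, q.2.2, q.2.1 1, q.2.1 2] = l := by
  obtain ⟨x, y, ξ, η, ⟨-, hy0, -, -⟩, ⟨hx, hy, hxy, hxk⟩, hne, hξ, hη, h1, ha⟩ :=
    mem_criticalValues_normalPlane.1 hl
  -- For η = 0 the vector ξ lies on l_0, l_1 and l_a, so the common point is [ξ : 0].
  by_cases hη0 : η = 0
  · have hξ0 : ξ ≠ 0 := by simpa [hη0] using hne
    subst hη0
    rw [add_zero] at h1
    rw [mul_zero, add_zero] at ha
    have e0 := im_mul_star_eq_zero_of_mem hξ hx
    have e1 := im_mul_star_eq_zero_of_mem h1 hxy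
    have ea := im_mul_star_eq_zero_of_mem ha hxk
    refine h.exists_mem_resolution_of_map_mem (x := (ξ, 0)) (by simpa using hξ0) hξ
      (by simpa using h1) (by simpa using ha) (mem_submodule_of_im_mul_star_eq_zero hy0 hy ?_)
      (fun e => absurd e hξ0) (fun e => absurd e (by simpa using hξ0))
      (fun e => absurd e (by simpa using hξ0))
    rw [conicMap_apply]
    simp at e0 e1 ea ⊢
    linear_combination (-ξ.im) * (ea - e0) + (ξ.im * a.re - ξ.re * a.im) * (e1 - e0)
  -- Subtracting r times the tangent vector makes the second coordinate zero; the first one becomes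
  -- the common point p.
  · obtain ⟨r, rfl⟩ := exists_smul_of_mem_submodule hη0 hη hy
    have g0 := Submodule.sub_mem _ hx (Submodule.smul_mem _ r hξ)
    have g1 := Submodule.sub_mem _ hxy (Submodule.smul_mem _ r h1)
    have ga := Submodule.sub_mem _ hxk (Submodule.smul_mem _ r ha)
    have i1 : x + r • η - 1 - r • (ξ + η) = (x - r • ξ) - 1 := by
      simp only [Complex.real_smul]
      ring
    have ia : x + k * r • η - a - r • (ξ + k * η) = (x - r • ξ) - a := by
      simp only [Complex.real_smul]
      ring
    rw [i1] at g1
    rw [ia] at ga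
    clear i1 ia hx hxy hxk hy0 hy hl
    generalize x - r • ξ = p at *
    have e0 := im_mul_star_eq_zero_of_mem hξ g0
    have e1 := im_mul_star_eq_zero_of_mem h1 g1
    have ea := im_mul_star_eq_zero_of_mem ha ga
    refine h.exists_mem_resolution_of_map_mem (x := (p, 1)) (by simp) g0
      (by simpa using g1) (by simpa using ga) (mem_submodule_of_im_mul_star_eq_zero hη0 hη ?_)
      (fun e => ?_) (fun e => ?_) (fun e => ?_)
    · rw [conicMap_apply]
      simp at e0 e1 ea ⊢
      linear_combination p.im * (ea - e0) - (p.im * a.re - p.re * a.im) * (e1 - e0) + a.im * e0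
    · obtain rfl : p = 0 := e
      refine ⟨ξ, ?_, hξ, mem_submodule_of_im_mul_star_eq_zero hη0 hη ?_⟩
      · rintro rfl
        refine hη0 (h.eq_zero_of_im_eq_zero ?_ ?_)
        · simpa using e1
        · simp at ea ⊢
          linear_combination ea
      · rw [polar_conicMap]
        simp at e0 e1 ea ⊢
        linear_combination ξ.im * ea + (ξ.re * a.im - ξ.im * a.re) * e1
    · obtain rfl : p = 1 := by simpa using e
      refine ⟨ξ + η, fun hu => ?_, h1, mem_submodule_of_im_mul_star_eq_zero hη0 hη ?_⟩
      · obtain rfl := eq_neg_of_add_eq_zero_left hu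
        refine hη0 (h.eq_zero_of_im_sub_eq_zero ?_ ?_)
        · simpa using e0
        · simp at ea ⊢
          linear_combination -ea
      · rw [polar_conicMap]
        simp at e0 e1 ea ⊢
        linear_combination (ξ.im + η.im) * ea +
          (η.im - η.im * a.re + a.im * (ξ.re + η.re) + ξ.im - ξ.im * a.re) * e0
    · obtain rfl : p = a := by simpa using e
      refine ⟨ξ + k * η, fun hu => ?_, ha, mem_submodule_of_im_mul_star_eq_zero hη0 hη ?_⟩
      · obtain rfl := eq_neg_of_add_eq_zero_left hu
        refine hη0 (h.eq_zero_of_im_mul_eq_zero ?_ ?_)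
        · simp at e0 ⊢
          linear_combination e0
        · simp at e1 ⊢
          linear_combination e1
      · rw [polar_conicMap]
        simp at e0 e1 ea ⊢
        linear_combination
          (((ξ.im + (k.re * η.im + k.im * η.re)) * p.re -
            (ξ.re + (k.re * η.re - k.im * η.im)) * p.im) - ξ.im -
              (k.re * η.im + k.im * η.re)) * e0 -
            ((ξ.im + (k.re * η.im + k.im * η.re)) * p.re -
              (ξ.re + (k.re * η.re - k.im * η.im)) * p.im) * e1

end IsGeneral

/-! ### From the resolution to critical values -/

namespace IsGeneral

variable {a k : ℂ}

/-- All points (p + sξ, sv) with s real have their coordinates on the prescribed lines. A coordinate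
vanishing for every s is excluded by general position, so some s makes all four nonzero. -/
theorem mem_criticalValues_of_mem (h : IsGeneral a k) {l : Fin 4 → RP1} {p ξ v : ℂ} (hv0 : v ≠ 0)
    (g0 : p ∈ (l 0).submodule) (g1 : p - 1 ∈ (l 2).submodule) (ga : p - a ∈ (l 3).submodule)
    (hξ : ξ ∈ (l 0).submodule) (hv : v ∈ (l 1).submodule) (h1 : ξ + v ∈ (l 2).submodule)
    (ha : ξ + k * v ∈ (l 3).submodule) : l ∈ criticalValues (normalPlane a k) := by
  have e0 := im_mul_star_eq_zero_of_mem g0 hξ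
  have e1 := im_mul_star_eq_zero_of_mem g1 h1
  have ea := im_mul_star_eq_zero_of_mem ga ha
  obtain ⟨s, hs⟩ := exists_real_forall_add_mul_ne_zero ![p, 0, p - 1, p - a]
    ![ξ, v, ξ + v, ξ + k * v] (by
      intro i
      fin_cases i
      · rintro (rfl : p = 0) (rfl : ξ = 0)
        refine hv0 (h.eq_zero_of_im_eq_zero ?_ ?_)
        · simpa using e1
        · simp at ea ⊢
          linear_combination -ea
      · exact fun _ => hv0
      · intro hp hu
        obtain rfl := sub_eq_zero.1 (show p - 1 = 0 from hp)
        obtain rfl := eq_neg_of_add_eq_zero_left (show ξ + v = 0 from hu)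
        refine hv0 (h.eq_zero_of_im_sub_eq_zero ?_ ?_)
        · simpa using e0
        · simp at ea ⊢
          linear_combination ea
      · intro hp hu
        obtain rfl := sub_eq_zero.1 (show p - a = 0 from hp)
        obtain rfl := eq_neg_of_add_eq_zero_left (show ξ + k * v = 0 from hu)
        refine hv0 (h.eq_zero_of_im_mul_eq_zero ?_ ?_)
        · simp at e0 ⊢
          linear_combination -e0
        · simp at e1 ⊢
          linear_combination -e1)
  have i1 : p + s * ξ + s * v - 1 = p - 1 + s • (ξ + v) := by
    rw [Complex.real_smul]
    ring
  have ia : p + s * ξ + k * (s * v) - a = p - a + s • (ξ + k * v) := by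
    rw [Complex.real_smul]
    ring
  refine mem_criticalValues_normalPlane.2 ⟨p + s * ξ, s * v, ξ, v, ⟨hs 0, ?_, ?_, ?_⟩,
    ⟨?_, ?_, ?_, ?_⟩, Or.inr hv0, hξ, hv, h1, ha⟩
  · simpa using hs 1
  · rw [i1]
    exact hs 2
  · rw [ia]
    exact hs 3
  · exact Submodule.add_mem _ g0 (by simpa using Submodule.smul_mem _ s hξ)
  · simpa using Submodule.smul_mem _ s hv
  · rw [i1]
    exact Submodule.add_mem _ g1 (Submodule.smul_mem _ s h1)
  · rw [ia]
    exact Submodule.add_mem _ ga (Submodule.smul_mem _ s ha)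

theorem mem_criticalValues_of_mem_resolution_of_affine (h : IsGeneral a k) {p : ℂ}
    {l : Fin 4 → RP1} {m : RP1}
    (hq : (affinePoint p, l, m) ∈ resolution (conicMap a k) ![0, 1, a, fourthPoint a k]) :
    ![l 0, m, l 1, l 2] ∈ criticalValues (normalPlane a k) := by
  have hx : ((p, 1) : ℂ × ℝ) ∈ (affinePoint p).submodule := self_mem_submodule_mk _ _
  have hx0 : ((p, 1) : ℂ × ℝ) ≠ 0 := by simp
  have g0 : p ∈ (l 0).submodule := by simpa using hq.1 0 _ hx
  have g1 : p - 1 ∈ (l 1).submodule := by simpa using hq.1 1 _ hx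
  have ga : p - a ∈ (l 2).submodule := by simpa using hq.1 2 _ hx
  have hv0 := m.rep_nonzero
  have hv := m.rep_mem_submodule
  have hF := im_mul_star_eq_zero_of_mem hv (h.isSimpleBaseLocus.map_mem_of_mem_resolution hq hx)
  have hP : ∀ i, p = (![0, 1, a, fourthPoint a k] : Fin 4 → ℂ) i →
      (polar (conicMap a k) (p, 1) ((l i).rep, 0) * star m.rep).im = 0 := by
    intro i hi
    refine im_mul_star_eq_zero_of_mem hv ?_
    have := (polar_mem_iff_of_fst_eq hx0 hx (by simpa using hi) (l i).rep_nonzero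
      (l i).rep_mem_submodule).1 (hq.2 i)
    rwa [← hi] at this
  generalize m.rep = v at *
  suffices ∃ ξ ∈ (l 0).submodule, ξ + v ∈ (l 1).submodule ∧ ξ + k * v ∈ (l 2).submodule by
    obtain ⟨ξ, h0, h1, h2⟩ := this
    exact h.mem_criticalValues_of_mem hv0 g0 g1 ga h0 hv h1 h2
  have ha := h.im_a
  have parallel : ∀ {x y : ℝ} (x' y' : ℝ), (x ≠ 0 ∨ y ≠ 0) → x * y' = y * x' →
      ∃ r : ℝ, r * x = x' ∧ r * y = y' := by
    rintro x y x' y' (hx | hy) hxy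
    · exact ⟨x' / x, div_mul_cancel₀ _ hx, by field_simp; linear_combination -hxy⟩
    · exact ⟨y' / y, by field_simp; linear_combination hxy, div_mul_cancel₀ _ hy⟩
  -- At 0, 1 or a one of the three lines is not determined by p, and `hF` is void. The condition
  -- `hP` on the differential of F takes its place.
  by_cases p0 : p = 0
  · have hP := hP 0 p0
    subst p0
    have hu := (l 0).rep_nonzero
    have hul := (l 0).rep_mem_submodule
    generalize (l 0).rep = u at *
    have hne : u.im ≠ 0 ∨ (u * star a).im ≠ 0 := by
      by_contra! hc
      obtain ⟨hc1, hc2⟩ := hc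
      simp [hc1, ha] at hc2
      exact hu (Complex.ext hc2 hc1)
    obtain ⟨r, hr1, hr2⟩ := parallel (-v.im) (-(k * v * star a).im) hne (by
      rw [polar_conicMap] at hP
      simp at hP ⊢
      linear_combination -hP)
    refine ⟨r • u, Submodule.smul_mem _ _ hul,
      mem_submodule_of_im_mul_star_eq_zero (by simp) g1 ?_,
      mem_submodule_of_im_mul_star_eq_zero (v := 0 - a) ?_ ga ?_⟩
    · simp
      linear_combination -hr1
    · rintro e
      simp at e
      exact ha (by simp [e])
    · simp at hr2 ⊢
      linear_combination -hr2
  by_cases p1 : p = 1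
  · have hP := hP 1 p1
    subst p1
    have hu := (l 1).rep_nonzero
    have hul := (l 1).rep_mem_submodule
    generalize (l 1).rep = u at *
    obtain ⟨r, hr⟩ : ∃ r : ℝ, r * a.im = -(k * v * star (1 - a)).im := ⟨_, div_mul_cancel₀ _ ha⟩
    refine ⟨r • 1, Submodule.smul_mem _ _ g0,
      mem_submodule_of_im_mul_star_eq_zero hu hul ?_,
      mem_submodule_of_im_mul_star_eq_zero (v := 1 - a) ?_ ga ?_⟩
    · rw [polar_conicMap] at hP
      refine (mul_eq_zero.1 (?_ : a.im * _ = 0)).resolve_left ha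
      simp [-mul_eq_zero] at hP hr ⊢
      linear_combination -hP - u.im * hr
    · rintro e
      refine ha ?_
      rw [← sub_eq_zero.1 e]
      rfl
    · simp at hr ⊢
      linear_combination hr
  by_cases pa : p = a
  · have hP := hP 2 pa
    subst pa
    have hu := (l 2).rep_nonzero
    have hul := (l 2).rep_mem_submodule
    generalize (l 2).rep = u at *
    refine ⟨((v * star (p - 1)).im / p.im : ℝ) • p, Submodule.smul_mem _ _ g0,
      mem_submodule_of_im_mul_star_eq_zero (sub_ne_zero.2 p1) g1 ?_,
      mem_submodule_of_im_mul_star_eq_zero hu hul ?_⟩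
    · simp
      field_simp
      ring
    · rw [polar_conicMap] at hP
      simp at hP ⊢
      field_simp
      linear_combination -hP
  -- Put ξ = rp. The conditions on l_1 and l_a are two real linear equations for r, compatible by
  -- `hF`.
  · have hne : p.im ≠ 0 ∨ (p * star a).im ≠ 0 := by
      by_contra! hc
      obtain ⟨hc1, hc2⟩ := hc
      simp [hc1, ha] at hc2
      exact p0 (Complex.ext hc2 hc1)
    obtain ⟨r, hr1, hr2⟩ := parallel (v * star (p - 1)).im (k * v * star (p - a)).im hne (by
      rw [conicMap_apply] at hF
      simp at hF ⊢
      linear_combination -hF)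
    refine ⟨r • p, Submodule.smul_mem _ _ g0,
      mem_submodule_of_im_mul_star_eq_zero (sub_ne_zero.2 p1) g1 ?_,
      mem_submodule_of_im_mul_star_eq_zero (sub_ne_zero.2 pa) ga ?_⟩
    · simp at hr1 ⊢
      linear_combination -hr1
    · simp at hr2 ⊢
      linear_combination -hr2

theorem mem_criticalValues_of_mem_resolution_of_infinite (h : IsGeneral a k) {p : RP2}
    {l : Fin 4 → RP1} {m : RP1}
    (hq : (p, l, m) ∈ resolution (conicMap a k) ![0, 1, a, fourthPoint a k]) {z : ℂ} (hz : z ≠ 0)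
    (hzp : ((z, 0) : ℂ × ℝ) ∈ p.submodule) :
    ![l 0, m, l 1, l 2] ∈ criticalValues (normalPlane a k) := by
  have g0 : z ∈ (l 0).submodule := by simpa using hq.1 0 _ hzp
  have g1 : z ∈ (l 1).submodule := by simpa using hq.1 1 _ hzp
  have ga : z ∈ (l 2).submodule := by simpa using hq.1 2 _ hzp
  have hv0 := m.rep_nonzero
  have hv := m.rep_mem_submodule
  have hF := im_mul_star_eq_zero_of_mem hv (h.isSimpleBaseLocus.map_mem_of_mem_resolution hq hzp)
  generalize m.rep = v at *
  rw [conicMap_apply] at hF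
  -- The three lines are all ℝz and the tangent vector is (z, 0). The second coordinate rv must
  -- satisfy rv - 1 ∈ ℝz and krv - a ∈ ℝz; these two real equations for r are compatible by `hF`.
  obtain ⟨r, hr1, hr2⟩ : ∃ r : ℝ, r * (v * star z).im = (star z).im ∧
      r * (k * v * star z).im = (a * star z).im := by
    by_cases h1 : (v * star z).im = 0
    · obtain ⟨t, rfl⟩ := mem_submodule_mk.1 (mem_submodule_mk_iff_im_eq_zero (hv := hz).2 h1)
      have ht : t ≠ 0 := by
        rintro rfl
        exact hv0 (zero_smul _ _)
      have h2 : (k * t • z * star z).im = t * k.im * Complex.normSq z := by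
        rw [Complex.normSq_apply]
        simp
        ring
      have h3 : t * k.im * Complex.normSq z ≠ 0 :=
        mul_ne_zero (mul_ne_zero ht h.im_k) (by simpa using hz)
      refine ⟨(a * star z).im / (k * t • z * star z).im, ?_, ?_⟩
      · have h4 : z.im * (t * k.im * Complex.normSq z) = 0 := by
          rw [Complex.normSq_apply]
          simp at hF
          linear_combination -hF
        have h5 : (star z).im = 0 := by simpa using (mul_eq_zero.1 h4).resolve_right h3
        rw [h1, h5, mul_zero]
      · rw [h2, div_mul_cancel₀ _ h3]
    · refine ⟨(star z).im / (v * star z).im, div_mul_cancel₀ _ h1, ?_⟩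
      field_simp
      simp at hF ⊢
      linear_combination hF
  have hr : r ≠ 0 := by
    rintro rfl
    have h1 : z.im = 0 := by simpa using hr1.symm
    simp [h1, h.im_a] at hr2
    exact hz (Complex.ext hr2 h1)
  have e1 : r * v - 1 ∈ (l 1).submodule := by
    refine mem_submodule_of_im_mul_star_eq_zero hz g1 ?_
    simp at hr1 ⊢
    linear_combination hr1
  have ea : k * (r * v) - a ∈ (l 2).submodule := by
    refine mem_submodule_of_im_mul_star_eq_zero hz ga ?_
    simp at hr2 ⊢
    linear_combination hr2
  obtain ⟨s, hs⟩ := exists_real_forall_add_mul_ne_zero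
    ![0, r * v - 1, k * (r * v) - a] (fun _ => z) (fun _ _ => hz)
  have i1 : s * z + r * v - 1 = r * v - 1 + s * z := by ring
  have ia : s * z + k * (r * v) - a = k * (r * v) - a + s * z := by ring
  refine mem_criticalValues_normalPlane.2 ⟨s * z, r * v, z, 0, ⟨?_, ?_, ?_, ?_⟩,
    ⟨?_, ?_, ?_, ?_⟩, Or.inl hz, g0, Submodule.zero_mem _, ?_, ?_⟩
  · simpa using hs 0
  · exact mul_ne_zero (by exact_mod_cast hr) hv0
  · rw [i1]
    exact hs 1
  · rw [ia]
    exact hs 2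
  · exact Submodule.smul_mem _ s g0
  · exact Submodule.smul_mem _ r hv
  · rw [i1]
    exact Submodule.add_mem _ e1 (Submodule.smul_mem _ s g1)
  · rw [ia]
    exact Submodule.add_mem _ ea (Submodule.smul_mem _ s ga)
  · simpa using g1
  · simpa using ga

theorem mem_criticalValues_of_mem_resolution (h : IsGeneral a k) {q : RP2 × (Fin 4 → RP1) × RP1}
    (hq : q ∈ resolution (conicMap a k) ![0, 1, a, fourthPoint a k]) :
    ![q.2.1 0, q.2.2, q.2.1 1, q.2.1 2] ∈ criticalValues (normalPlane a k) := by
  obtain ⟨p, l, m⟩ := q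
  have hx := p.rep_mem_submodule
  have hx0 := p.rep_nonzero
  generalize p.rep = x at *
  obtain ⟨z, w⟩ := x
  by_cases hw : w = 0
  · subst hw
    exact h.mem_criticalValues_of_mem_resolution_of_infinite hq (fun e => hx0 (by rw [e]; rfl)) hx
  · have h1 : p = affinePoint (z / w) := by
      refine eq_of_mem_submodule hx0 hx (mem_submodule_mk.2 ⟨w, ?_⟩)
      have : (w : ℂ) ≠ 0 := by exact_mod_cast hw
      refine Prod.ext ?_ ?_
      · simp
        field_simp
      · simp
    subst h1
    exact h.mem_criticalValues_of_mem_resolution_of_affine hq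

theorem inter_projLine_of_mem_resolution (h : IsGeneral a k) {q : RP2 × (Fin 4 → RP1) × RP1}
    (hq : q ∈ resolution (conicMap a k) ![0, 1, a, fourthPoint a k]) :
    projLine 0 (q.2.1 0) ∩ projLine 1 (q.2.1 1) ∩ projLine a (q.2.1 2) = {q.1} :=
  inter_projLine_eq_singleton h.im_a (hq.1 0) (hq.1 1) (hq.1 2)

/-- The critical values of a plane which a diagonal map `c` carries to `normalPlane a k` are
parametrized by the resolution. -/
theorem exists_homeomorph_criticalValues (h : IsGeneral a k) {V : AffineSubspace ℂ (Fin 4 → ℂ)}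
    (hV : Module.finrank ℂ V.direction = 2) {c : Fin 4 → ℂˣ}
    (hc : (fun (v : Fin 4 → ℂ) (i : Fin 4) => (c i : ℂ) * v i) '' (V : Set (Fin 4 → ℂ)) =
      (normalPlane a k : Set (Fin 4 → ℂ))) :
    ∃ e : resolution (conicMap a k) ![0, 1, a, fourthPoint a k] ≃ₜ criticalValues V, ∀ q,
      (fun i => c i • (e q : Fin 4 → RP1) i) =
        ![(q : RP2 × (Fin 4 → RP1) × RP1).2.1 0, (q : RP2 × (Fin 4 → RP1) × RP1).2.2,
          (q : RP2 × (Fin 4 → RP1) × RP1).2.1 1, (q : RP2 × (Fin 4 → RP1) × RP1).2.1 2] := by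
  have hN := finrank_direction_normalPlane a k
  have hc1 : ∀ v ∈ V, c • v ∈ normalPlane a k := fun v hv => by
    have : c • v ∈ (normalPlane a k : Set (Fin 4 → ℂ)) := hc ▸ ⟨v, hv, rfl⟩
    exact this
  have hc2 : ∀ v ∈ normalPlane a k, c⁻¹ • v ∈ V := fun v hv => by
    have : v ∈ (normalPlane a k : Set (Fin 4 → ℂ)) := hv
    rw [← hc] at this
    obtain ⟨u, hu, rfl⟩ := this
    have e : c⁻¹ • (fun i => (c i : ℂ) * u i) = u := inv_smul_smul c u
    rw [e]
    exact hu
  have := isCompact_iff_compactSpace.1 h.isSimpleBaseLocus.isCompact_resolution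
  let f : resolution (conicMap a k) ![0, 1, a, fourthPoint a k] → (Fin 4 → RP1) := fun q =>
    ![(q : RP2 × (Fin 4 → RP1) × RP1).2.1 0, (q : RP2 × (Fin 4 → RP1) × RP1).2.2,
      (q : RP2 × (Fin 4 → RP1) × RP1).2.1 1, (q : RP2 × (Fin 4 → RP1) × RP1).2.1 2]
  have hf : Continuous f := by
    refine continuous_pi fun i => ?_
    fin_cases i
    · change Continuous fun q : resolution _ _ => q.1.2.1 0
      fun_prop
    · change Continuous fun q : resolution _ _ => q.1.2.2
      fun_prop
    · change Continuous fun q : resolution _ _ => q.1.2.1 1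
      fun_prop
    · change Continuous fun q : resolution _ _ => q.1.2.1 2
      fun_prop
  -- The three directions determine the point; the point and the member then determine the fourth
  -- direction.
  have hfi : Function.Injective f := by
    rintro ⟨⟨p, l, m⟩, hq⟩ ⟨⟨p', l', m'⟩, hq'⟩ e
    have e0 : l 0 = l' 0 := congrFun e 0
    have e1 : l 1 = l' 1 := congrFun e 2
    have e2 : l 2 = l' 2 := congrFun e 3
    obtain rfl : m = m' := congrFun e 1
    have h1 := h.inter_projLine_of_mem_resolution hq
    have h2 := h.inter_projLine_of_mem_resolution hq'
    simp only at h1 h2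
    rw [e0, e1, e2, h2] at h1
    obtain rfl := Set.singleton_injective h1
    obtain rfl := h.isSimpleBaseLocus.injOn_universalCurve hq hq'
    rfl
  have hg : Continuous fun q i => (c i)⁻¹ • f q i := continuous_pi fun i =>
    (continuous_smul_of_continuous (c i)⁻¹).comp ((continuous_apply i).comp hf)
  have hgi : Function.Injective fun q i => (c i)⁻¹ • f q i := by
    intro q q' e
    exact hfi (funext fun i => smul_left_cancel (c i)⁻¹ (congrFun e i))
  obtain ⟨e, he⟩ := exists_homeomorph_of_range_eq hg hgi (S := criticalValues V) (by
    ext l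
    constructor
    · rintro ⟨q, rfl⟩
      exact smul_mem_criticalValues hN hV (c := c⁻¹) hc2
        (h.mem_criticalValues_of_mem_resolution q.2)
    · intro hl
      obtain ⟨q, hq, hql⟩ := h.exists_mem_resolution_of_criticalValue
        (smul_mem_criticalValues hV hN hc1 hl)
      refine ⟨⟨q, hq⟩, funext fun i => ?_⟩
      have : f ⟨q, hq⟩ i = c i • l i := congrFun hql i
      simp only [this, inv_smul_smul])
  refine ⟨e, fun q => funext fun i => ?_⟩
  rw [he, smul_inv_smul]

end IsGeneral

/-! ### Generic conditions through rational functions -/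

section Generic

variable {X σ : Type*}

/-- `p` holds outside of the zero set of a polynomial in the coordinates `φ` that does not vanish
at `x₀`. -/
def GenericAt (φ : X → σ → ℝ) (x₀ : X) (p : X → Prop) : Prop :=
  ∃ P : MvPolynomial σ ℝ, MvPolynomial.eval (φ x₀) P ≠ 0 ∧
    ∀ x, MvPolynomial.eval (φ x) P ≠ 0 → p x

/-- `f` is a rational function of the coordinates `φ` that is regular at `x₀`. -/
def RegularAt (φ : X → σ → ℝ) (x₀ : X) (f : X → ℝ) : Prop :=
  ∃ P Q : MvPolynomial σ ℝ, MvPolynomial.eval (φ x₀) Q ≠ 0 ∧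
    ∀ x, MvPolynomial.eval (φ x) Q ≠ 0 → f x = MvPolynomial.eval (φ x) P / MvPolynomial.eval (φ x) Q

/-- The real and imaginary parts of `f` are rational functions regular at `x₀`. -/
def ComplexRegularAt (φ : X → σ → ℝ) (x₀ : X) (f : X → ℂ) : Prop :=
  RegularAt φ x₀ (fun x => (f x).re) ∧ RegularAt φ x₀ (fun x => (f x).im)

variable {φ : X → σ → ℝ} {x₀ : X}

theorem GenericAt.and {p q : X → Prop} (hp : GenericAt φ x₀ p) (hq : GenericAt φ x₀ q) :
    GenericAt φ x₀ fun x => p x ∧ q x := by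
  obtain ⟨P, hP, h1⟩ := hp
  obtain ⟨Q, hQ, h2⟩ := hq
  refine ⟨P * Q, by simpa using ⟨hP, hQ⟩, fun x hx => ?_⟩
  rw [map_mul, mul_ne_zero_iff] at hx
  exact ⟨h1 x hx.1, h2 x hx.2⟩

theorem GenericAt.mono {p q : X → Prop} (hp : GenericAt φ x₀ p) (h : ∀ x, p x → q x) :
    GenericAt φ x₀ q := by
  obtain ⟨P, hP, h1⟩ := hp
  exact ⟨P, hP, fun x hx => h x (h1 x hx)⟩

namespace RegularAt

variable {f g : X → ℝ}

theorem const (c : ℝ) : RegularAt φ x₀ fun _ => c :=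
  ⟨MvPolynomial.C c, 1, by simp, fun x _ => by simp⟩

theorem coord (i : σ) : RegularAt φ x₀ fun x => φ x i :=
  ⟨MvPolynomial.X i, 1, by simp, fun x _ => by simp⟩

theorem add (hf : RegularAt φ x₀ f) (hg : RegularAt φ x₀ g) :
    RegularAt φ x₀ fun x => f x + g x := by
  obtain ⟨P, Q, hQ, h1⟩ := hf
  obtain ⟨R, S, hS, h2⟩ := hg
  refine ⟨P * S + Q * R, Q * S, by simpa using ⟨hQ, hS⟩, fun x hx => ?_⟩
  rw [map_mul, mul_ne_zero_iff] at hx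
  change f x + g x = _
  rw [h1 x hx.1, h2 x hx.2, div_add_div _ _ hx.1 hx.2]
  simp

theorem mul (hf : RegularAt φ x₀ f) (hg : RegularAt φ x₀ g) :
    RegularAt φ x₀ fun x => f x * g x := by
  obtain ⟨P, Q, hQ, h1⟩ := hf
  obtain ⟨R, S, hS, h2⟩ := hg
  refine ⟨P * R, Q * S, by simpa using ⟨hQ, hS⟩, fun x hx => ?_⟩
  rw [map_mul, mul_ne_zero_iff] at hx
  change f x * g x = _
  rw [h1 x hx.1, h2 x hx.2, div_mul_div_comm, map_mul, map_mul]

theorem neg (hf : RegularAt φ x₀ f) : RegularAt φ x₀ fun x => -f x := by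
  simpa using (const (-1)).mul hf

theorem sub (hf : RegularAt φ x₀ f) (hg : RegularAt φ x₀ g) :
    RegularAt φ x₀ fun x => f x - g x := by
  simpa only [sub_eq_add_neg] using hf.add hg.neg

theorem inv (hf : RegularAt φ x₀ f) (h0 : f x₀ ≠ 0) : RegularAt φ x₀ fun x => (f x)⁻¹ := by
  obtain ⟨P, Q, hQ, h1⟩ := hf
  rw [h1 x₀ hQ, div_ne_zero_iff] at h0
  refine ⟨Q * Q, P * Q, by simpa using ⟨h0.1, hQ⟩, fun x hx => ?_⟩
  rw [map_mul, mul_ne_zero_iff] at hx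
  change (f x)⁻¹ = _
  rw [h1 x hx.2, inv_div, map_mul, map_mul, mul_div_mul_right _ _ hx.2]

theorem div (hf : RegularAt φ x₀ f) (hg : RegularAt φ x₀ g) (h0 : g x₀ ≠ 0) :
    RegularAt φ x₀ fun x => f x / g x := by
  simpa only [div_eq_mul_inv] using hf.mul (hg.inv h0)

theorem genericAt_ne_zero (hf : RegularAt φ x₀ f) (h0 : f x₀ ≠ 0) :
    GenericAt φ x₀ fun x => f x ≠ 0 := by
  obtain ⟨P, Q, hQ, h1⟩ := hf
  rw [h1 x₀ hQ, div_ne_zero_iff] at h0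
  refine ⟨P * Q, by simpa using ⟨h0.1, hQ⟩, fun x hx => ?_⟩
  rw [map_mul, mul_ne_zero_iff] at hx
  rw [h1 x hx.2]
  exact div_ne_zero hx.1 hx.2

end RegularAt

namespace ComplexRegularAt

variable {f g : X → ℂ}

theorem const (c : ℂ) : ComplexRegularAt φ x₀ fun _ => c :=
  ⟨RegularAt.const _, RegularAt.const _⟩

theorem ofReal {f : X → ℝ} (hf : RegularAt φ x₀ f) : ComplexRegularAt φ x₀ fun x => (f x : ℂ) :=
  ⟨hf, RegularAt.const _⟩

theorem im (hf : ComplexRegularAt φ x₀ f) : RegularAt φ x₀ fun x => (f x).im := hf.2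

theorem add (hf : ComplexRegularAt φ x₀ f) (hg : ComplexRegularAt φ x₀ g) :
    ComplexRegularAt φ x₀ fun x => f x + g x :=
  ⟨hf.1.add hg.1, hf.2.add hg.2⟩

theorem sub (hf : ComplexRegularAt φ x₀ f) (hg : ComplexRegularAt φ x₀ g) :
    ComplexRegularAt φ x₀ fun x => f x - g x :=
  ⟨hf.1.sub hg.1, hf.2.sub hg.2⟩

theorem mul (hf : ComplexRegularAt φ x₀ f) (hg : ComplexRegularAt φ x₀ g) :
    ComplexRegularAt φ x₀ fun x => f x * g x :=
  ⟨(hf.1.mul hg.1).sub (hf.2.mul hg.2), (hf.1.mul hg.2).add (hf.2.mul hg.1)⟩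

theorem star (hf : ComplexRegularAt φ x₀ f) : ComplexRegularAt φ x₀ fun x => star (f x) :=
  ⟨hf.1, hf.2.neg⟩

theorem normSq (hf : ComplexRegularAt φ x₀ f) : RegularAt φ x₀ fun x => Complex.normSq (f x) :=
  (hf.1.mul hf.1).add (hf.2.mul hf.2)

theorem div (hf : ComplexRegularAt φ x₀ f) (hg : ComplexRegularAt φ x₀ g) (h0 : g x₀ ≠ 0) :
    ComplexRegularAt φ x₀ fun x => f x / g x := by
  have h1 := hf.mul (hg.star.mul (ofReal (hg.normSq.inv (by simpa using h0))))
  have e : (fun x => f x / g x) =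
      fun x => f x * (Star.star (g x) * (((Complex.normSq (g x))⁻¹ : ℝ) : ℂ)) := by
    funext x
    rw [div_eq_mul_inv, Complex.inv_def]
    rfl
  rw [e]
  exact h1

theorem genericAt_ne_zero (hf : ComplexRegularAt φ x₀ f) (h0 : f x₀ ≠ 0) :
    GenericAt φ x₀ fun x => f x ≠ 0 :=
  (hf.normSq.genericAt_ne_zero (by simpa using h0)).mono fun x hx => by simpa using hx

end ComplexRegularAt

theorem fourthPoint_I_two_add_I : fourthPoint Complex.I (2 + Complex.I) = -1 + Complex.I := by
  have h : (star (2 + Complex.I) - ((1 : ℝ) : ℂ)) ≠ 0 := by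
    intro h
    simpa using congrArg Complex.im h
  have e : (Complex.I * star Complex.I * star (2 + Complex.I) +
      (2 + Complex.I) * star (2 + Complex.I) * Complex.I + star Complex.I * (2 + Complex.I)).im /
      (star (2 + Complex.I) * Complex.I + star Complex.I + (2 + Complex.I)).im = 1 := by
    simp
    norm_num
  simp only [fourthPoint, e]
  rw [div_eq_iff h]
  refine Complex.ext ?_ ?_
  · simp
    norm_num
  · simp

/-- The fourth point is itself rational in a, k and their conjugates, so every condition can be
tested at the sample a = i, k = 2 + i, where t = 1 and the fourth point is -1 + i. -/
theorem genericAt_isGeneral {a k : X → ℂ} (ha : ComplexRegularAt φ x₀ a)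
    (hk : ComplexRegularAt φ x₀ k) (ha0 : a x₀ = Complex.I) (hk0 : k x₀ = 2 + Complex.I) :
    GenericAt φ x₀ fun x => IsGeneral (a x) (k x) := by
  have h4 : (star (k x₀) * a x₀ + star (a x₀) + k x₀).im ≠ 0 := by
    rw [ha0, hk0]
    simp
  have hd : ComplexRegularAt φ x₀ fun x => fourthPoint (a x) (k x) := by
    have h5 : RegularAt φ x₀ fun x => (a x * star (a x) * star (k x) + k x * star (k x) * a x +
        star (a x) * k x).im / (star (k x) * a x + star (a x) + k x).im := by
      refine RegularAt.div ?_ ?_ h4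
      · exact ((((ha.mul ha.star).mul hk.star).add ((hk.mul hk.star).mul ha)).add
          (ha.star.mul hk)).im
      · exact (((hk.star.mul ha).add ha.star).add hk).im
    refine ((hk.star.mul ha).sub (.ofReal h5)).div (hk.star.sub (.ofReal h5)) fun h => ?_
    have := congrArg Complex.im h
    rw [Complex.sub_im, Complex.ofReal_im, hk0] at this
    simp at this
  have hP : ∀ {s : X → ℂ}, ComplexRegularAt φ x₀ s →
      RegularAt φ x₀ fun x => polarDet (a x) (k x) (s x) := by
    intro s hs
    have h6 : ∀ v : ℂ, ComplexRegularAt φ x₀ fun x =>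
        polar (conicMap (a x) (k x)) (s x, 1) (v, 0) := by
      intro v
      simp only [polar_conicMap]
      exact ((((ComplexRegularAt.const _).mul (hk.star.mul (hs.sub ha))).add
        ((ComplexRegularAt.ofReal hs.im).mul (hk.star.mul (.const v)))).sub
        ((ComplexRegularAt.ofReal ((ComplexRegularAt.const v).mul ha.star).im).mul
          (hs.sub (.const 1)))).sub ((ComplexRegularAt.ofReal (hs.mul ha.star).im).mul (.const v))
    exact ((h6 1).star.mul (h6 Complex.I)).im
  have one : ComplexRegularAt φ x₀ fun _ : X => (1 : ℂ) := .const 1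
  refine GenericAt.mono
    ((ha.im.genericAt_ne_zero (by simp [ha0])).and <|
    (hk.im.genericAt_ne_zero (by simp [hk0])).and <|
    ((hk.mul ha.star).im.genericAt_ne_zero (by simp [ha0, hk0])).and <|
    (((one.sub hk).mul (one.sub ha.star)).im.genericAt_ne_zero
      (by simp [ha0, hk0]; norm_num)).and <|
    ((((ha.mul (hk.sub one)).mul hk.star).mul (ha.star.sub one)).im.genericAt_ne_zero
      (by simp [ha0, hk0]; norm_num)).and <|
    ((((hk.star.mul ha).add ha.star).add hk).im.genericAt_ne_zero h4).and <|
    (hd.genericAt_ne_zero ?_).and <|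
    ((hd.sub one).genericAt_ne_zero ?_).and <|
    ((hd.sub ha).genericAt_ne_zero ?_).and <|
    ((hP (.const 0)).genericAt_ne_zero ?_).and <|
    ((hP one).genericAt_ne_zero ?_).and <|
    ((hP ha).genericAt_ne_zero ?_).and <|
    ((hP hd).genericAt_ne_zero ?_))
    ?_
  · rw [ha0, hk0, fourthPoint_I_two_add_I]
    simp [Complex.ext_iff]
  · rw [ha0, hk0, fourthPoint_I_two_add_I]
    simp [Complex.ext_iff]
  · rw [ha0, hk0, fourthPoint_I_two_add_I]
    simp
  · rw [ha0, hk0, polarDet, polar_conicMap, polar_conicMap]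
    simp
  · rw [ha0, hk0, polarDet, polar_conicMap, polar_conicMap]
    simp
  · rw [ha0, hk0, polarDet, polar_conicMap, polar_conicMap]
    simp
    norm_num
  · rw [ha0, hk0, fourthPoint_I_two_add_I, polarDet, polar_conicMap, polar_conicMap]
    simp
    norm_num
  · rintro x ⟨h1, h2, h3, h4, h5, h6, h7, h8, h9, h10, h11, h12, h13⟩
    exact ⟨h1, h2, h3, h4, h5, h6, h7, sub_ne_zero.1 h8, sub_ne_zero.1 h9, h10, h11, h12, h13⟩

end Generic

/-! ### Reduction to the normal form -/

theorem complexRegularAt_entry {M₀ : Matrix (Fin 4) (Fin 3) ℂ} (i : Fin 4) (j : Fin 3) :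
    ComplexRegularAt realCoords M₀ fun M => M i j :=
  ⟨RegularAt.coord (i, j, 0), RegularAt.coord (i, j, 1)⟩

/-- The minor of the linear parts of the affine forms given by the rows `i` and `j`. -/
def linearMinor (i j : Fin 4) (M : Matrix (Fin 4) (Fin 3) ℂ) : ℂ := M i 0 * M j 1 - M i 1 * M j 0

/-- The determinant of the rows `0`, `1`, `i`. -/
def rowDet (i : Fin 4) (M : Matrix (Fin 4) (Fin 3) ℂ) : ℂ :=
  linearMinor 0 1 M * M i 2 - linearMinor i 1 M * M 0 2 - linearMinor 0 i M * M 1 2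

theorem complexRegularAt_linearMinor {M₀ : Matrix (Fin 4) (Fin 3) ℂ} (i j : Fin 4) :
    ComplexRegularAt realCoords M₀ (linearMinor i j) :=
  ((complexRegularAt_entry i 0).mul (complexRegularAt_entry j 1)).sub
    ((complexRegularAt_entry i 1).mul (complexRegularAt_entry j 0))

theorem complexRegularAt_rowDet {M₀ : Matrix (Fin 4) (Fin 3) ℂ} (i : Fin 4) :
    ComplexRegularAt realCoords M₀ (rowDet i) :=
  (((complexRegularAt_linearMinor 0 1).mul (complexRegularAt_entry i 2)).sub
    ((complexRegularAt_linearMinor i 1).mul (complexRegularAt_entry 0 2))).sub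
    ((complexRegularAt_linearMinor 0 i).mul (complexRegularAt_entry 1 2))

/-- Rescaling the coordinates brings a general affine plane into the normal form. -/
theorem exists_image_planeOf_eq_normalPlane {M : Matrix (Fin 4) (Fin 3) ℂ}
    (h01 : linearMinor 0 1 M ≠ 0) (h21 : linearMinor 2 1 M ≠ 0) (h02 : linearMinor 0 2 M ≠ 0)
    (h31 : linearMinor 3 1 M ≠ 0) (h2 : rowDet 2 M ≠ 0) :
    ∃ c : Fin 4 → ℂˣ, (fun (v : Fin 4 → ℂ) (i : Fin 4) => (c i : ℂ) * v i) ''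
      (planeOf M : Set (Fin 4 → ℂ)) =
        (normalPlane (linearMinor 2 1 M * rowDet 3 M / (rowDet 2 M * linearMinor 3 1 M))
          (linearMinor 2 1 M * linearMinor 0 3 M / (linearMinor 3 1 M * linearMinor 0 2 M)) :
          Set (Fin 4 → ℂ)) := by
  -- Cramer's rule expresses the i-th affine form through the forms 0 and 1 and a constant.
  have key : ∀ (i : Fin 4) (s t : ℂ), linearMinor 0 1 M * (M i 0 * s + M i 1 * t + M i 2) =
      linearMinor i 1 M * (M 0 0 * s + M 0 1 * t + M 0 2) +
        linearMinor 0 i M * (M 1 0 * s + M 1 1 * t + M 1 2) + rowDet i M := by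
    intro i s t
    simp only [rowDet, linearMinor]
    ring
  have solve : ∀ x y : ℂ, ∃ s t : ℂ,
      M 0 0 * s + M 0 1 * t + M 0 2 = x ∧ M 1 0 * s + M 1 1 * t + M 1 2 = y := by
    intro x y
    refine ⟨((x - M 0 2) * M 1 1 - (y - M 1 2) * M 0 1) / linearMinor 0 1 M,
      ((y - M 1 2) * M 0 0 - (x - M 0 2) * M 1 0) / linearMinor 0 1 M, ?_, ?_⟩
    · field_simp
      simp only [linearMinor]
      ring
    · field_simp
      simp only [linearMinor]
      ring
  have key2 := key 2
  have key3 := key 3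
  clear key
  generalize linearMinor 0 1 M = D01 at *
  generalize linearMinor 2 1 M = D21 at *
  generalize linearMinor 3 1 M = D31 at *
  generalize linearMinor 0 2 M = D02 at *
  generalize linearMinor 0 3 M = D03 at *
  generalize rowDet 2 M = T2 at *
  generalize rowDet 3 M = T3 at *
  -- Dividing `key2` by -T2 gives x + y - 1 and fixes the scalings of the coordinates 0, 1, 2. The
  -- last one is chosen so that x has coefficient 1 in `key3`; k and a are then read off.
  have n0 : -D21 / T2 ≠ 0 := div_ne_zero (neg_ne_zero.2 h21) h2
  have n1 : -D02 / T2 ≠ 0 := div_ne_zero (neg_ne_zero.2 h02) h2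
  have n2 : -D01 / T2 ≠ 0 := div_ne_zero (neg_ne_zero.2 h01) h2
  have n3 : -(D21 * D01) / (T2 * D31) ≠ 0 :=
    div_ne_zero (neg_ne_zero.2 (mul_ne_zero h21 h01)) (mul_ne_zero h2 h31)
  let c : Fin 4 → ℂˣ := ![Units.mk0 _ n0, Units.mk0 _ n1, Units.mk0 _ n2, Units.mk0 _ n3]
  let N : Matrix (Fin 4) (Fin 3) ℂ :=
    !![1, 0, 0; 0, 1, 0; 1, 1, -1; 1, D21 * D03 / (D31 * D02), -(D21 * T3 / (T2 * D31))]
  have scale : ∀ s t : ℂ, ∀ i, (c i : ℂ) * (M i 0 * s + M i 1 * t + M i 2) =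
      N i 0 * (-D21 / T2 * (M 0 0 * s + M 0 1 * t + M 0 2)) +
        N i 1 * (-D02 / T2 * (M 1 0 * s + M 1 1 * t + M 1 2)) + N i 2 := by
    intro s t
    have e2 := key2 s t
    have e3 := key3 s t
    simp only [Fin.forall_fin_succ, Fin.succ_zero_eq_one, IsEmpty.forall_iff, and_true, c, N]
    simp
    refine ⟨?_, ?_⟩
    · field_simp
      linear_combination -e2
    · field_simp
      linear_combination -e3
  refine ⟨c, Set.ext fun v => ⟨?_, fun hv => ?_⟩⟩
  · rintro ⟨u, hu, rfl⟩
    obtain ⟨s, t, hu⟩ := mem_planeOf.1 hu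
    refine mem_planeOf.2 ⟨-D21 / T2 * (M 0 0 * s + M 0 1 * t + M 0 2),
      -D02 / T2 * (M 1 0 * s + M 1 1 * t + M 1 2), fun i => ?_⟩
    simp only [hu]
    exact scale s t i
  · obtain ⟨x, y, hv⟩ := mem_planeOf.1 hv
    obtain ⟨s, t, hx, hy⟩ := solve (x / (-D21 / T2)) (y / (-D02 / T2))
    refine ⟨fun i => M i 0 * s + M i 1 * t + M i 2, mem_planeOf.2 ⟨s, t, fun i => rfl⟩,
      funext fun i => ?_⟩
    rw [hv i]
    refine (scale s t i).trans ?_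
    rw [hx, hy, mul_div_cancel₀ _ n0, mul_div_cancel₀ _ n1]

/-! ### The main theorem -/

theorem theorem1 :
    ∃ P : MvPolynomial (Fin 4 × Fin 3 × Fin 2) ℝ, P ≠ 0 ∧
      ∀ M : Matrix (Fin 4) (Fin 3) ℂ, MvPolynomial.eval (realCoords M) P ≠ 0 →
        ∃ (c : Fin 4 → ℂˣ) (a k d : ℂ),
          -- the plane in normal form
          (fun (v : Fin 4 → ℂ) (i : Fin 4) => (c i : ℂ) * v i) ''
              (planeOf M : Set (Fin 4 → ℂ)) = (normalPlane a k : Set (Fin 4 → ℂ)) ∧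
          Function.Injective (![0, 1, a, d] : Fin 4 → ℂ) ∧
          ∃ Q : ℂ →ₗ[ℝ] QuadraticForm ℝ (ℂ × ℝ),
            -- a pencil of conics with base points `0, 1, a, d`
            Function.Injective Q ∧
            (⋂ v : ℂ, conic (Q v)) =
              {affinePoint 0, affinePoint 1, affinePoint a, affinePoint d} ∧
            ∃ (Φ : criticalValues (planeOf M) ≃ₜ universalCurve Q)
              (Ψ : criticalValues (planeOf M) ≃ₜ blowUp (![0, 1, a, d] : Fin 4 → ℂ)),
              ∀ (b : criticalValues (planeOf M)) (l : Fin 4 → RP1),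
                (l = fun i => c i • (b : Fin 4 → RP1) i) →
                  -- `Φ b = (p, l 1)` with `p` the only common point of three projective lines
                  projLine 0 (l 0) ∩ projLine 1 (l 2) ∩ projLine a (l 3) =
                    {(Φ b : RP2 × RP1).1} ∧
                  (Φ b : RP2 × RP1).2 = l 1 ∧
                  (Ψ b : RP2 × (Fin 4 → RP1)).1 = (Φ b : RP2 × RP1).1 := by
  -- The sample plane is already in normal form, with a = i and k = 2 + i.
  let M₀ : Matrix (Fin 4) (Fin 3) ℂ :=
    !![1, 0, 0; 0, 1, 0; 1, 1, -1; 1, 2 + Complex.I, -Complex.I]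
  have hD := fun i j => complexRegularAt_linearMinor (M₀ := M₀) i j
  have hT := fun i => complexRegularAt_rowDet (M₀ := M₀) i
  have d01 : linearMinor 0 1 M₀ = 1 := by simp [linearMinor, M₀]
  have d21 : linearMinor 2 1 M₀ = 1 := by simp [linearMinor, M₀]
  have d31 : linearMinor 3 1 M₀ = 1 := by simp [linearMinor, M₀]
  have d02 : linearMinor 0 2 M₀ = 1 := by simp [linearMinor, M₀]
  have d03 : linearMinor 0 3 M₀ = 2 + Complex.I := by simp [linearMinor, M₀]
  have t2 : rowDet 2 M₀ = -1 := by simp [linearMinor, rowDet, M₀]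
  have t3 : rowDet 3 M₀ = -Complex.I := by simp [linearMinor, rowDet, M₀]
  have hgen := genericAt_isGeneral
    (((hD 2 1).mul (hT 3)).div ((hT 2).mul (hD 3 1)) (by simp [t2, d31]))
    (((hD 2 1).mul (hD 0 3)).div ((hD 3 1).mul (hD 0 2)) (by simp [d31, d02]))
    (by simp [d21, d31, t2, t3]) (by simp [d21, d03, d31, d02])
  obtain ⟨P, hP, h⟩ := ((hD 0 1).genericAt_ne_zero (by simp [d01])).and <|
    ((hD 2 1).genericAt_ne_zero (by simp [d21])).and <|
    ((hD 0 2).genericAt_ne_zero (by simp [d02])).and <|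
    ((hD 3 1).genericAt_ne_zero (by simp [d31])).and <|
    ((hT 2).genericAt_ne_zero (by simp [t2])).and hgen
  refine ⟨P, fun h0 => hP (by rw [h0, map_zero]), fun M hM => ?_⟩
  obtain ⟨h01, h21, h02, h31, h2, hg⟩ := h M hM
  obtain ⟨c, hc⟩ := exists_image_planeOf_eq_normalPlane h01 h21 h02 h31 h2
  generalize linearMinor 2 1 M * rowDet 3 M / (rowDet 2 M * linearMinor 3 1 M) = a at hc hg
  generalize linearMinor 2 1 M * linearMinor 0 3 M / (linearMinor 3 1 M * linearMinor 0 2 M) = k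
    at hc hg
  have hs := hg.isSimpleBaseLocus
  obtain ⟨e, he⟩ := hg.exists_homeomorph_criticalValues (finrank_direction_planeOf h01) hc
  obtain ⟨Φ, hΦ⟩ := hs.exists_homeomorph_universalCurve
  obtain ⟨Ψ, hΨ⟩ := hs.exists_homeomorph_blowUp
  refine ⟨c, a, k, fourthPoint a k, hc, hg.injective, pencil (conicMap a k), hs.injective_pencil,
    ?_, e.symm.trans Φ, e.symm.trans Ψ, ?_⟩
  · rw [hs.iInter_conic_pencil]
    ext p
    simp [Fin.exists_fin_succ, eq_comm]
  · intro b l hl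
    obtain ⟨q, rfl⟩ := e.surjective b
    rw [he] at hl
    subst hl
    simp only [Homeomorph.trans_apply, Homeomorph.symm_apply_apply, hΦ, hΨ]
    exact ⟨hg.inter_projLine_of_mem_resolution q.2, rfl, trivial⟩
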